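/- All trees are finite, rooted and non-planar; leaves and bald (i.e. nullary) vertices are allowed, and a tree is called \emph{open} if it has no bald vertex. Let $\Omega$ be the category of trees, where a morphism $S\to T$ is a map $\Omega(S)\to\Omega(T)$ of the coloured symmetric operads freely generated by the trees. Let $\Omega[T]$ be the representable dendroidal set (presheaf on $\Omega$) of $T$, also denoted $T$. For trees $S,T$ let $S\otimes T=\Omega[S]\otimes\Omega[T]$ be the dendroidal nerve of the Boardman--Vogt tensor product $\Omega(S)\otimes_{BV}\Omega(T)$. For dendroidal subsets $A\subseteq\Omega[S]$ and $B\subseteq\Omega[T]$ write $A\otimes B\subseteq S\otimes T$ for the image of the canonical map, i.e. for the union of the images of the maps $S'\otimes T'\to S\otimes T$ over all $(S'\to S)\in A$ and $(T'\to T)\in B$. The \emph{elementary faces} of a tree $T$ are the following subobjects $\partial_xT\subseteq T$, where the index $x$ is one of: \begin{itemize} \item an inner edge $x$: $\partial_xT$ is obtained by contracting $x$; \item a top vertex $x$, i.e. a vertex all of whose inputs are leaves: $\partial_xT$ is obtained by deleting $x$ and its inputs; \item the root vertex $x$, provided that exactly one inner edge $e$ is attached to it: $\partial_xT$ is the subtree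 of everything above $e$, with root edge $e$; \item if $T$ is a corolla (a tree with exactly one vertex), any edge $x$: $\partial_xT$ is the edge $x$. \end{itemize} Let $S$ and $T$ be trees, let $\partial_xS$ be an elementary face of $S$, and let $\partial_yT$, $\partial_zT$ be elementary faces of $T$. (i) If $S$ is open, then, as dendroidal subsets of $S\otimes T$, $$S\otimes\partial_yT\ \cap\ S\otimes\partial_zT\ =\ S\otimes(\partial_yT\cap\partial_zT).$$ (ii) If $S$ and $T$ are both open, then, as dendroidal subsets of $S\otimes T$, $$\partial_xS\otimes T\ \cap\ S\otimes\partial_yT\ =\ \partial_xS\otimes\partial_yT.$$ -/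

import Mathlib

open CategoryTheory

namespace Dendroidal

/-! ### Coloured symmetric operads -/

/-- A coloured symmetric operad (in sets).  Operations have a finite set `I` of inputs, coloured
by `c : I → Color`, and one output; `relabel` is the action of bijections of the input set (hence
in particular of the symmetric groups). -/
structure Operad where
  /-- the colours -/
  Color : Type
  /-- the operations with inputs coloured by `c` and output of colour `x` -/
  Op : ∀ {I : Type} [Finite I], (I → Color) → Color → Type 1
  /-- the identity operations -/
  id : ∀ x : Color, Op (fun _ : Unit => x) x
  /-- the action of bijections between input sets -/
  relabel : ∀ {I J : Type} [Finite I] [Finite J] {c : I → Color} {c' : J → Color} {x : Color}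
    (e : I ≃ J), (∀ i, c' (e i) = c i) → Op c x → Op c' x
  /-- the composition of an operation with one operation for each of its inputs -/
  comp : ∀ {I : Type} [Finite I] {J : I → Type} [∀ i, Finite (J i)] {c : I → Color}
    {b : ∀ i, J i → Color} {x : Color}, Op c x → (∀ i, Op (b i) (c i)) →
    Op (fun s : (Σ i, J i) => b s.1 s.2) x
  relabel_refl : ∀ {I : Type} [Finite I] {c : I → Color} {x : Color} (p : Op c x),
    relabel (Equiv.refl I) (fun _ => rfl) p = p
  relabel_trans : ∀ {I J K : Type} [Finite I] [Finite J] [Finite K] {c : I → Color}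
    {c' : J → Color} {c'' : K → Color} {x : Color} (e : I ≃ J) (f : J ≃ K)
    (he : ∀ i, c' (e i) = c i) (hf : ∀ j, c'' (f j) = c' j) (p : Op c x),
    relabel f hf (relabel e he p) = relabel (e.trans f) (fun i => (hf (e i)).trans (he i)) p
  comp_relabel_left : ∀ {I I' : Type} [Finite I] [Finite I'] {J : I' → Type}
    [∀ i, Finite (J i)] {c : I' → Color} {b : ∀ i, J i → Color} {x : Color} (e : I ≃ I')
    (p : Op (fun i => c (e i)) x) (q : ∀ i, Op (b i) (c i)),
    comp (relabel (c' := c) e (fun _ => rfl) p) q =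
      relabel (Equiv.sigmaCongrLeft e) (fun _ => rfl) (comp p (fun i => q (e i)))
  comp_relabel_right : ∀ {I : Type} [Finite I] {J J' : I → Type} [∀ i, Finite (J i)]
    [∀ i, Finite (J' i)] {c : I → Color} {b : ∀ i, J i → Color} {b' : ∀ i, J' i → Color}
    {x : Color} (e : ∀ i, J i ≃ J' i) (h : ∀ i j, b' i (e i j) = b i j)
    (p : Op c x) (q : ∀ i, Op (b i) (c i)),
    comp p (fun i => relabel (e i) (h i) (q i)) =
      relabel (Equiv.sigmaCongrRight e) (fun s => h s.1 s.2) (comp p q)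
  id_comp : ∀ {I : Type} [Finite I] {c : I → Color} {x : Color} (q : Op c x),
    relabel (c' := c) (Equiv.uniqueSigma (fun _ : Unit => I)) (fun _ => rfl)
      (comp (id x) (fun _ => q)) = q
  comp_id : ∀ {I : Type} [Finite I] {c : I → Color} {x : Color} (p : Op c x),
    relabel (c' := c) (Equiv.sigmaPUnit I) (fun _ => rfl) (comp p (fun i => id (c i))) = p
  assoc : ∀ {I : Type} [Finite I] {J : I → Type} [∀ i, Finite (J i)]
    {K : ∀ i, J i → Type} [∀ i j, Finite (K i j)] {c : I → Color} {b : ∀ i, J i → Color}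
    {a : ∀ i j, K i j → Color} {x : Color} (p : Op c x) (q : ∀ i, Op (b i) (c i))
    (r : ∀ i j, Op (a i j) (b i j)),
    relabel (c' := fun s : (Σ i, Σ j, K i j) => a s.1 s.2.1 s.2.2) (Equiv.sigmaAssoc K)
      (fun _ => rfl) (comp (comp p q) (fun s => r s.1 s.2)) =
      comp p (fun i => comp (q i) (r i))

/-- Morphisms of coloured symmetric operads. -/
@[ext]
structure Operad.Hom (P Q : Operad) where
  onColor : P.Color → Q.Color
  onOp : ∀ {I : Type} [Finite I] {c : I → P.Color} {x : P.Color},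
    P.Op c x → Q.Op (fun i => onColor (c i)) (onColor x)
  map_id : ∀ x, onOp (P.id x) = Q.id (onColor x)
  map_relabel : ∀ {I J : Type} [Finite I] [Finite J] {c : I → P.Color} {c' : J → P.Color}
    {x : P.Color} (e : I ≃ J) (h : ∀ i, c' (e i) = c i) (p : P.Op c x),
    onOp (P.relabel e h p) = Q.relabel e (fun i => congrArg onColor (h i)) (onOp p)
  map_comp : ∀ {I : Type} [Finite I] {J : I → Type} [∀ i, Finite (J i)] {c : I → P.Color}
    {b : ∀ i, J i → P.Color} {x : P.Color} (p : P.Op c x) (q : ∀ i, P.Op (b i) (c i)),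
    onOp (P.comp p q) = Q.comp (onOp p) (fun i => onOp (q i))

/-- The category of coloured symmetric operads. -/
instance : Category Operad where
  Hom := Operad.Hom
  id P :=
    { onColor := fun x => x
      onOp := fun p => p
      map_id := fun _ => rfl
      map_relabel := fun _ _ _ => rfl
      map_comp := fun _ _ => rfl }
  comp F G :=
    { onColor := fun x => G.onColor (F.onColor x)
      onOp := fun p => G.onOp (F.onOp p)
      map_id := fun x => by rw [F.map_id, G.map_id]
      map_relabel := fun e h p => by rw [F.map_relabel, G.map_relabel]
      map_comp := fun p q => by rw [F.map_comp, G.map_comp] }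

/-! ### The Boardman-Vogt tensor product -/

/-- Formal composites of the generators `p ⊗ d` and `c ⊗ q` of the Boardman-Vogt tensor product,
for `p` an operation of `P`, `d` a colour of `Q`, `c` a colour of `P`, `q` an operation of `Q`. -/
inductive BVTerm (P Q : Operad) :
    ∀ {I : Type}, (I → P.Color × Q.Color) → P.Color × Q.Color → Type 1
  | left {I : Type} [Finite I] {a : I → P.Color} {a' : P.Color} (p : P.Op a a') (d : Q.Color) :
      BVTerm P Q (fun i => (a i, d)) (a', d)
  | right {J : Type} [Finite J] {b : J → Q.Color} {b' : Q.Color} (c : P.Color) (q : Q.Op b b') :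
      BVTerm P Q (fun j => (c, b j)) (c, b')
  | id (x : P.Color × Q.Color) : BVTerm P Q (fun _ : Unit => x) x
  | relabel {I J : Type} {c : I → P.Color × Q.Color} {c' : J → P.Color × Q.Color}
      {x : P.Color × Q.Color} (e : I ≃ J) (h : ∀ i, c' (e i) = c i) (t : BVTerm P Q c x) :
      BVTerm P Q c' x
  | comp {I : Type} {J : I → Type} {c : I → P.Color × Q.Color}
      {b : ∀ i, J i → P.Color × Q.Color} {x : P.Color × Q.Color} (t : BVTerm P Q c x)
      (u : ∀ i, BVTerm P Q (b i) (c i)) : BVTerm P Q (fun s : (Σ i, J i) => b s.1 s.2) x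

/-- The congruence on formal composites that imposes the operad axioms, the functoriality of
`p ↦ p ⊗ d` and `q ↦ c ⊗ q`, and the Boardman-Vogt interchange relation. -/
inductive BVRel (P Q : Operad) :
    ∀ {I : Type} {c : I → P.Color × Q.Color} {x : P.Color × Q.Color},
      BVTerm P Q c x → BVTerm P Q c x → Prop
  -- equivalence relation and congruence
  | refl {I : Type} {c : I → P.Color × Q.Color} {x : P.Color × Q.Color} (t : BVTerm P Q c x) :
      BVRel P Q t t
  | symm {I : Type} {c : I → P.Color × Q.Color} {x : P.Color × Q.Color} {t u : BVTerm P Q c x} :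
      BVRel P Q t u → BVRel P Q u t
  | trans {I : Type} {c : I → P.Color × Q.Color} {x : P.Color × Q.Color}
      {t u v : BVTerm P Q c x} : BVRel P Q t u → BVRel P Q u v → BVRel P Q t v
  | congr_relabel {I J : Type} {c : I → P.Color × Q.Color} {c' : J → P.Color × Q.Color}
      {x : P.Color × Q.Color} (e : I ≃ J) (h : ∀ i, c' (e i) = c i) {t u : BVTerm P Q c x} :
      BVRel P Q t u → BVRel P Q (.relabel e h t) (.relabel e h u)
  | congr_comp {I : Type} {J : I → Type} {c : I → P.Color × Q.Color}
      {b : ∀ i, J i → P.Color × Q.Color} {x : P.Color × Q.Color} {t t' : BVTerm P Q c x}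
      {u u' : ∀ i, BVTerm P Q (b i) (c i)} :
      BVRel P Q t t' → (∀ i, BVRel P Q (u i) (u' i)) → BVRel P Q (.comp t u) (.comp t' u')
  -- operad axioms
  | relabel_refl {I : Type} {c : I → P.Color × Q.Color} {x : P.Color × Q.Color}
      (t : BVTerm P Q c x) : BVRel P Q (.relabel (Equiv.refl I) (fun _ => rfl) t) t
  | relabel_trans {I J K : Type} {c : I → P.Color × Q.Color} {c' : J → P.Color × Q.Color}
      {c'' : K → P.Color × Q.Color} {x : P.Color × Q.Color} (e : I ≃ J) (f : J ≃ K)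
      (he : ∀ i, c' (e i) = c i) (hf : ∀ j, c'' (f j) = c' j) (t : BVTerm P Q c x) :
      BVRel P Q (.relabel f hf (.relabel e he t))
        (.relabel (e.trans f) (fun i => (hf (e i)).trans (he i)) t)
  | comp_relabel_left {I I' : Type} {J : I' → Type} {c : I' → P.Color × Q.Color}
      {b : ∀ i, J i → P.Color × Q.Color} {x : P.Color × Q.Color} (e : I ≃ I')
      (t : BVTerm P Q (fun i => c (e i)) x) (u : ∀ i, BVTerm P Q (b i) (c i)) :
      BVRel P Q (.comp (.relabel (c' := c) e (fun _ => rfl) t) u)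
        (.relabel (Equiv.sigmaCongrLeft e) (fun _ => rfl) (.comp t (fun i => u (e i))))
  | comp_relabel_right {I : Type} {J J' : I → Type} {c : I → P.Color × Q.Color}
      {b : ∀ i, J i → P.Color × Q.Color} {b' : ∀ i, J' i → P.Color × Q.Color}
      {x : P.Color × Q.Color} (e : ∀ i, J i ≃ J' i) (h : ∀ i j, b' i (e i j) = b i j)
      (t : BVTerm P Q c x) (u : ∀ i, BVTerm P Q (b i) (c i)) :
      BVRel P Q (.comp t (fun i => .relabel (e i) (h i) (u i)))
        (.relabel (Equiv.sigmaCongrRight e) (fun s => h s.1 s.2) (.comp t u))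
  | id_comp {I : Type} {c : I → P.Color × Q.Color} {x : P.Color × Q.Color}
      (t : BVTerm P Q c x) :
      BVRel P Q (.relabel (c' := c) (Equiv.uniqueSigma (fun _ : Unit => I)) (fun _ => rfl)
        (.comp (.id x) (fun _ => t))) t
  | comp_id {I : Type} {c : I → P.Color × Q.Color} {x : P.Color × Q.Color}
      (t : BVTerm P Q c x) :
      BVRel P Q (.relabel (c' := c) (Equiv.sigmaPUnit I) (fun _ => rfl)
        (.comp t (fun i => .id (c i)))) t
  | assoc {I : Type} {J : I → Type} {K : ∀ i, J i → Type} {c : I → P.Color × Q.Color}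
      {b : ∀ i, J i → P.Color × Q.Color} {a : ∀ i j, K i j → P.Color × Q.Color}
      {x : P.Color × Q.Color} (t : BVTerm P Q c x) (u : ∀ i, BVTerm P Q (b i) (c i))
      (w : ∀ i j, BVTerm P Q (a i j) (b i j)) :
      BVRel P Q (.relabel (c' := fun s : (Σ i, Σ j, K i j) => a s.1 s.2.1 s.2.2)
        (Equiv.sigmaAssoc K) (fun _ => rfl) (.comp (.comp t u) (fun s => w s.1 s.2)))
        (.comp t (fun i => .comp (u i) (w i)))
  -- functoriality of `p ↦ p ⊗ d`
  | left_id (a : P.Color) (d : Q.Color) : BVRel P Q (.left (P.id a) d) (.id (a, d))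
  | left_relabel {I J : Type} [Finite I] [Finite J] {a : I → P.Color} {a' : J → P.Color}
      {x : P.Color} (e : I ≃ J) (h : ∀ i, a' (e i) = a i) (p : P.Op a x) (d : Q.Color) :
      BVRel P Q (.left (P.relabel e h p) d)
        (.relabel e (fun i => congrArg (fun z => (z, d)) (h i)) (.left p d))
  | left_comp {I : Type} [Finite I] {J : I → Type} [∀ i, Finite (J i)] {c : I → P.Color}
      {b : ∀ i, J i → P.Color} {x : P.Color} (p : P.Op c x) (q : ∀ i, P.Op (b i) (c i))
      (d : Q.Color) :
      BVRel P Q (.left (P.comp p q) d) (.comp (.left p d) (fun i => .left (q i) d))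
  -- functoriality of `q ↦ c ⊗ q`
  | right_id (c : P.Color) (b : Q.Color) : BVRel P Q (.right c (Q.id b)) (.id (c, b))
  | right_relabel {I J : Type} [Finite I] [Finite J] {a : I → Q.Color} {a' : J → Q.Color}
      {x : Q.Color} (e : I ≃ J) (h : ∀ i, a' (e i) = a i) (c : P.Color) (q : Q.Op a x) :
      BVRel P Q (.right c (Q.relabel e h q))
        (.relabel e (fun i => congrArg (fun z => (c, z)) (h i)) (.right c q))
  | right_comp {I : Type} [Finite I] {J : I → Type} [∀ i, Finite (J i)] {a : I → Q.Color}
      {b : ∀ i, J i → Q.Color} {x : Q.Color} (c : P.Color) (p : Q.Op a x)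
      (q : ∀ i, Q.Op (b i) (a i)) :
      BVRel P Q (.right c (Q.comp p q)) (.comp (.right c p) (fun i => .right c (q i)))
  -- the Boardman-Vogt interchange relation
  | interchange {I J : Type} [Finite I] [Finite J] {a : I → P.Color} {a' : P.Color}
      {b : J → Q.Color} {b' : Q.Color} (p : P.Op a a') (q : Q.Op b b') :
      BVRel P Q
        (.relabel (c' := fun s : (Σ _ : J, I) => (a s.2, b s.1))
          ((Equiv.sigmaEquivProd I J).trans
            ((Equiv.prodComm I J).trans (Equiv.sigmaEquivProd J I).symm))
          (fun _ => rfl) (.comp (.left p b') (fun i => .right (a i) q)))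
        (.comp (.right a' q) (fun j => .left p (b j)))

/-- Formal composites up to the Boardman-Vogt congruence. -/
instance bvSetoid (P Q : Operad) {I : Type} (c : I → P.Color × Q.Color)
    (x : P.Color × Q.Color) : Setoid (BVTerm P Q c x) where
  r := BVRel P Q
  iseqv := ⟨BVRel.refl, BVRel.symm, BVRel.trans⟩

theorem bvOut {P Q : Operad} {I : Type} {c : I → P.Color × Q.Color} {x : P.Color × Q.Color}
    (t : BVTerm P Q c x) : BVRel P Q (Quotient.mk (bvSetoid P Q c x) t).out t :=
  Quotient.mk_out (s := bvSetoid P Q c x) t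

/-- Composition of classes of formal composites. -/
noncomputable def bvComp {P Q : Operad} {I : Type} {J : I → Type} {c : I → P.Color × Q.Color}
    {b : ∀ i, J i → P.Color × Q.Color} {x : P.Color × Q.Color}
    (t : Quotient (bvSetoid P Q c x)) (u : ∀ i, Quotient (bvSetoid P Q (b i) (c i))) :
    Quotient (bvSetoid P Q (fun s : (Σ i, J i) => b s.1 s.2) x) :=
  Quotient.mk _ (.comp t.out (fun i => (u i).out))

theorem bvComp_mk {P Q : Operad} {I : Type} {J : I → Type} {c : I → P.Color × Q.Color}
    {b : ∀ i, J i → P.Color × Q.Color} {x : P.Color × Q.Color}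
    (t : BVTerm P Q c x) (u : ∀ i, BVTerm P Q (b i) (c i)) :
    bvComp (Quotient.mk _ t) (fun i => Quotient.mk _ (u i)) = Quotient.mk _ (.comp t u) :=
  Quotient.sound (BVRel.congr_comp (bvOut t) (fun i => bvOut (u i)))

/-- The action of bijections of input sets on classes of formal composites. -/
def bvRelabel {P Q : Operad} {I J : Type} {c : I → P.Color × Q.Color}
    {c' : J → P.Color × Q.Color} {x : P.Color × Q.Color} (e : I ≃ J)
    (h : ∀ i, c' (e i) = c i) (t : Quotient (bvSetoid P Q c x)) :
    Quotient (bvSetoid P Q c' x) :=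
  Quotient.map (BVTerm.relabel e h) (fun _ _ r => BVRel.congr_relabel e h r) t

theorem bvExists {P Q : Operad} {ι : Type} {I : ι → Type} {c : ∀ k, I k → P.Color × Q.Color}
    {x : ι → P.Color × Q.Color} (q : ∀ k, Quotient (bvSetoid P Q (c k) (x k))) :
    ∃ u : ∀ k, BVTerm P Q (c k) (x k), q = fun k => Quotient.mk _ (u k) :=
  ⟨fun k => (q k).out, funext fun k => (Quotient.out_eq (q k)).symm⟩

/-- The Boardman-Vogt tensor product of coloured symmetric operads. -/
noncomputable def BV (P Q : Operad) : Operad where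
  Color := P.Color × Q.Color
  Op c x := Quotient (bvSetoid P Q c x)
  id x := Quotient.mk _ (.id x)
  relabel e h t := bvRelabel e h t
  comp t u := bvComp t u
  relabel_refl := by
    intro I _ c x p
    induction p using Quotient.inductionOn with | _ p => ?_
    exact Quotient.sound (BVRel.relabel_refl p)
  relabel_trans := by
    intro I J K _ _ _ c c' c'' x e f he hf p
    induction p using Quotient.inductionOn with | _ p => ?_
    exact Quotient.sound (BVRel.relabel_trans e f he hf p)
  comp_relabel_left := by
    intro I I' _ _ J _ c b x e p q
    induction p using Quotient.inductionOn with | _ p => ?_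
    obtain ⟨u, rfl⟩ := bvExists q
    rw [bvComp_mk p (fun i => u (e i))]
    exact (bvComp_mk (.relabel (c' := c) e (fun _ => rfl) p) u).trans
      (Quotient.sound (BVRel.comp_relabel_left e p u))
  comp_relabel_right := by
    intro I _ J J' _ _ c b b' x e h p q
    induction p using Quotient.inductionOn with | _ p => ?_
    obtain ⟨u, rfl⟩ := bvExists q
    rw [bvComp_mk p u]
    exact (bvComp_mk p (fun i => .relabel (e i) (h i) (u i))).trans
      (Quotient.sound (BVRel.comp_relabel_right e h p u))
  id_comp := by
    intro I _ c x q
    induction q using Quotient.inductionOn with | _ q => ?_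
    rw [bvComp_mk (.id x) (fun _ : Unit => q)]
    exact Quotient.sound (BVRel.id_comp q)
  comp_id := by
    intro I _ c x p
    induction p using Quotient.inductionOn with | _ p => ?_
    rw [bvComp_mk p (fun i => .id (c i))]
    exact Quotient.sound (BVRel.comp_id p)
  assoc := by
    intro I _ J _ K _ c b a x p q r
    induction p using Quotient.inductionOn with | _ p => ?_
    obtain ⟨u, rfl⟩ := bvExists q
    choose w hw using fun i j => Quotient.exists_rep (r i j)
    obtain rfl : r = fun i j => Quotient.mk _ (w i j) := funext fun i => funext fun j =>
      (hw i j).symm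
    rw [bvComp_mk p u, bvComp_mk (.comp p u) (fun s => w s.1 s.2)]
    simp only [bvComp_mk]
    exact Quotient.sound (BVRel.assoc p u w)

/-- Functoriality of formal composites. -/
def BVTerm.map {P P' Q Q' : Operad} (F : P ⟶ P') (G : Q ⟶ Q') :
    ∀ {I : Type} {c : I → P.Color × Q.Color} {x : P.Color × Q.Color}, BVTerm P Q c x →
      BVTerm P' Q' (fun i => (F.onColor (c i).1, G.onColor (c i).2))
        (F.onColor x.1, G.onColor x.2)
  | _, _, _, @BVTerm.left _ _ _ _ _ _ p d => .left (F.onOp p) (G.onColor d)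
  | _, _, _, @BVTerm.right _ _ _ _ _ _ c q => .right (F.onColor c) (G.onOp q)
  | _, _, _, .id x => .id (F.onColor x.1, G.onColor x.2)
  | _, _, _, .relabel e h t =>
      .relabel e (fun i => congrArg (fun z => (F.onColor z.1, G.onColor z.2)) (h i))
        (BVTerm.map F G t)
  | _, _, _, .comp (b := b) t u =>
      .comp (b := fun i j => (F.onColor (b i j).1, G.onColor (b i j).2)) (BVTerm.map F G t)
        (fun i => BVTerm.map F G (u i))

theorem BVRel.map {P P' Q Q' : Operad} (F : P ⟶ P') (G : Q ⟶ Q') {I : Type}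
    {c : I → P.Color × Q.Color} {x : P.Color × Q.Color} {t u : BVTerm P Q c x}
    (r : BVRel P Q t u) : BVRel P' Q' (t.map F G) (u.map F G) := by
  induction r with
  | refl t => exact .refl _
  | symm _ ih => exact .symm ih
  | trans _ _ ih ih' => exact .trans ih ih'
  | congr_relabel e h _ ih => exact .congr_relabel e _ ih
  | congr_comp _ _ ih ih' => exact .congr_comp ih ih'
  | relabel_refl t => exact .relabel_refl _
  | relabel_trans e f he hf t => exact .relabel_trans e f _ _ _
  | @comp_relabel_left I I' J c b x e t u =>
    exact .comp_relabel_left (c := fun i => (F.onColor (c i).1, G.onColor (c i).2))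
      (b := fun i j => (F.onColor (b i j).1, G.onColor (b i j).2)) e _ _
  | @comp_relabel_right I J J' c b b' x e h t u =>
    exact .comp_relabel_right (b := fun i j => (F.onColor (b i j).1, G.onColor (b i j).2))
      (b' := fun i j => (F.onColor (b' i j).1, G.onColor (b' i j).2)) e
      (fun i j => congrArg (fun z => (F.onColor z.1, G.onColor z.2)) (h i j)) _ _
  | id_comp t => exact .id_comp _
  | comp_id t => exact .comp_id _
  | @assoc I J K c b a x t u w =>
    exact .assoc (b := fun i j => (F.onColor (b i j).1, G.onColor (b i j).2))
      (a := fun i j k => (F.onColor (a i j k).1, G.onColor (a i j k).2)) (t.map F G)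
      (fun i => (u i).map F G) (fun i j => (w i j).map F G)
  | left_id a d =>
    simp only [BVTerm.map]; rw [F.map_id]; exact .left_id _ _
  | left_relabel e h p d =>
    simp only [BVTerm.map]; rw [F.map_relabel]; exact .left_relabel e _ _ _
  | left_comp p q d =>
    simp only [BVTerm.map]; rw [F.map_comp]; exact .left_comp _ _ _
  | right_id c b =>
    simp only [BVTerm.map]; rw [G.map_id]; exact .right_id _ _
  | right_relabel e h c q =>
    simp only [BVTerm.map]; rw [G.map_relabel]; exact .right_relabel e _ _ _
  | right_comp c p q =>
    simp only [BVTerm.map]; rw [G.map_comp]; exact .right_comp _ _ _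
  | interchange p q => exact .interchange (F.onOp p) (G.onOp q)

/-- Functoriality of the Boardman-Vogt tensor product. -/
noncomputable def BV.map {P P' Q Q' : Operad} (F : P ⟶ P') (G : Q ⟶ Q') : BV P Q ⟶ BV P' Q' where
  onColor x := (F.onColor x.1, G.onColor x.2)
  onOp t := Quotient.map (BVTerm.map F G) (fun _ _ r => BVRel.map F G r) t
  map_id _ := rfl
  map_relabel := by
    intro I J _ _ c c' x e h p
    induction p using Quotient.inductionOn with | _ p => ?_
    rfl
  map_comp := by
    intro I _ J _ c b x p q
    induction p using Quotient.inductionOn with | _ p => ?_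
    obtain ⟨u, rfl⟩ := bvExists q
    refine (congrArg (Quotient.map (BVTerm.map F G) (fun _ _ r => BVRel.map F G r))
      (bvComp_mk p u)).trans ?_
    exact (bvComp_mk (b := fun i j => (F.onColor (b i j).1, G.onColor (b i j).2))
      (p.map F G) (fun i => (u i).map F G)).symm

/-! ### Trees and the operads they generate -/

/-- A finite rooted (non-planar) tree.  Every vertex `v` has one outgoing edge `out v` and a
(possibly empty) set `inp v` of input edges; the outer edges are the root and the leaves. -/
structure OmegaTree where
  /-- edges -/
  E : Type
  /-- vertices -/
  V : Type
  finite_E : Finite E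
  /-- the outgoing edge of a vertex (towards the root) -/
  out : V → E
  /-- the input edges of a vertex -/
  inp : V → Set E
  /-- the root edge -/
  root : E
  out_injective : Function.Injective out
  inp_unique : ∀ {e : E} {v w : V}, e ∈ inp v → e ∈ inp w → v = w
  root_notMem : ∀ v, root ∉ inp v
  reach_root : ∀ e, Relation.ReflTransGen (fun a b => ∃ v, a ∈ inp v ∧ out v = b) e root

namespace OmegaTree

/-- `T.Step a b`: the edge `b` is the next edge below `a` on the path to the root. -/
def Step (T : OmegaTree) (a b : T.E) : Prop := ∃ v, a ∈ T.inp v ∧ T.out v = b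

/-- `T.Above a b`: the edge `b` lies on the path from the edge `a` to the root. -/
def Above (T : OmegaTree) (a b : T.E) : Prop := Relation.ReflTransGen T.Step a b

theorem step_unique (T : OmegaTree) : Relator.RightUnique T.Step := by
  rintro a b c ⟨v, hv, rfl⟩ ⟨w, hw, rfl⟩
  rw [T.inp_unique hv hw]

theorem acyclic (T : OmegaTree) (e : T.E) : ¬ Relation.TransGen T.Step e e := by
  refine Relation.ReflTransGen.head_induction_on (T.reach_root e) ?_ ?_
  · intro h
    obtain ⟨b, ⟨v, hv, -⟩, -⟩ := Relation.TransGen.head'_iff.1 h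
    exact T.root_notMem v hv
  · intro a c hac _ ih h
    obtain ⟨b, hab, hba⟩ := Relation.TransGen.head'_iff.1 h
    obtain rfl := T.step_unique hab hac
    exact ih (Relation.TransGen.tail' hba hab)

/-- `T.Span L e`: there is a subtree of `T` with root `e` and set of leaves `L`. -/
inductive Span (T : OmegaTree) : Set T.E → T.E → Prop
  | edge (e : T.E) : Span T {e} e
  | graft (v : T.V) (L : T.E → Set T.E) (h : ∀ e ∈ T.inp v, Span T (L e) e) :
      Span T (⋃ e ∈ T.inp v, L e) (T.out v)

theorem Span.of_eq {T : OmegaTree} {L M : Set T.E} {e : T.E} (h : T.Span L e) (hLM : L = M) :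
    T.Span M e := hLM ▸ h

theorem Span.vertex (T : OmegaTree) (v : T.V) : T.Span (T.inp v) (T.out v) :=
  (Span.graft v (fun e => {e}) (fun e _ => Span.edge e)).of_eq (by simp)

theorem Span.bind {T : OmegaTree} {L : Set T.E} {e : T.E} (h : T.Span L e)
    (M : T.E → Set T.E) (hM : ∀ l ∈ L, T.Span (M l) l) : T.Span (⋃ l ∈ L, M l) e := by
  induction h with
  | edge e => exact (hM e rfl).of_eq (by simp)
  | graft v L _ ih =>
    refine (Span.graft v (fun e => ⋃ l ∈ L e, M l) (fun e he => ih e he ?_)).of_eq ?_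
    · intro l hl
      exact hM l (Set.mem_biUnion he hl)
    · ext x
      simp only [Set.mem_iUnion]
      constructor
      · rintro ⟨e, he, l, hl, hx⟩
        exact ⟨l, ⟨e, he, hl⟩, hx⟩
      · rintro ⟨l, ⟨e, he, hl⟩, hx⟩
        exact ⟨e, he, l, hl, hx⟩

theorem Span.above {T : OmegaTree} {L : Set T.E} {e : T.E} (h : T.Span L e) :
    ∀ l ∈ L, T.Above l e := by
  induction h with
  | edge e => rintro l rfl; exact Relation.ReflTransGen.refl
  | graft v L _ ih =>
    intro l hl
    simp only [Set.mem_iUnion] at hl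
    obtain ⟨e, he, hl⟩ := hl
    exact (ih e he l hl).tail ⟨v, he, rfl⟩

theorem inp_eq_of_above {T : OmegaTree} {v : T.V} {e e' : T.E} (he : e ∈ T.inp v)
    (he' : e' ∈ T.inp v) (h : T.Above e e') : e = e' := by
  rcases Relation.ReflTransGen.cases_head h with h | ⟨b, ⟨w, hw, rfl⟩, hb⟩
  · exact h
  · obtain rfl := T.inp_unique he hw
    exact (T.acyclic _ (Relation.TransGen.tail' hb ⟨v, he', rfl⟩)).elim

theorem Span.eq_of_above {T : OmegaTree} {L : Set T.E} {e : T.E} (h : T.Span L e) :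
    ∀ l ∈ L, ∀ l' ∈ L, ∀ x, T.Above x l → T.Above x l' → l = l' := by
  induction h with
  | edge e => rintro l rfl l' rfl x _ _; rfl
  | graft v L hL ih =>
    intro l hl l' hl' x hx hx'
    simp only [Set.mem_iUnion] at hl hl'
    obtain ⟨e, he, hl⟩ := hl
    obtain ⟨e', he', hl'⟩ := hl'
    have h1 : T.Above x e := hx.trans ((hL e he).above l hl)
    have h2 : T.Above x e' := hx'.trans ((hL e' he').above l' hl')
    have hee : e = e' := by
      rcases Relation.ReflTransGen.total_of_right_unique T.step_unique h1 h2 with h | h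
      · exact inp_eq_of_above he he' h
      · exact (inp_eq_of_above he' he h).symm
    subst hee
    exact ih e he l hl l' hl' x hx hx'

/-- The operations of the free operad on a tree: there is exactly one operation with inputs `c`
and output `x` if `c` enumerates without repetition the leaves of a subtree with root `x`, and
none otherwise. -/
structure TreeOp (T : OmegaTree) {I : Type} (c : I → T.E) (x : T.E) : Type 1 where
  injective : Function.Injective c
  span : T.Span (Set.range c) x

instance (T : OmegaTree) {I : Type} (c : I → T.E) (x : T.E) : Subsingleton (T.TreeOp c x) :=
  ⟨fun ⟨_, _⟩ ⟨_, _⟩ => rfl⟩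

theorem comp_range {T : OmegaTree} {I : Type} {J : I → Type} {c : I → T.E} {b : ∀ i, J i → T.E}
    {x : T.E} (p : T.TreeOp c x) (q : ∀ i, T.TreeOp (b i) (c i)) :
    T.Span (Set.range (fun s : (Σ i, J i) => b s.1 s.2)) x := by
  refine (p.span.bind (fun l => ⋃ i : { i // c i = l }, Set.range (b i.1)) ?_).of_eq ?_
  · rintro _ ⟨i, rfl⟩
    refine (q i).span.of_eq ?_
    ext y
    simp only [Set.mem_iUnion]
    constructor
    · intro hy
      exact ⟨⟨i, rfl⟩, hy⟩
    · rintro ⟨⟨k, hk⟩, hy⟩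
      obtain rfl := p.injective hk
      exact hy
  · ext y
    simp only [Set.mem_iUnion, Set.mem_range]
    constructor
    · rintro ⟨_, ⟨i, rfl⟩, ⟨k, _⟩, j, rfl⟩
      exact ⟨⟨k, j⟩, rfl⟩
    · rintro ⟨⟨i, j⟩, rfl⟩
      exact ⟨c i, ⟨i, rfl⟩, ⟨i, rfl⟩, j, rfl⟩

theorem comp_injective {T : OmegaTree} {I : Type} {J : I → Type} {c : I → T.E}
    {b : ∀ i, J i → T.E} {x : T.E} (p : T.TreeOp c x) (q : ∀ i, T.TreeOp (b i) (c i)) :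
    Function.Injective (fun s : (Σ i, J i) => b s.1 s.2) := by
  rintro ⟨i, j⟩ ⟨i', j'⟩ h
  have h1 : T.Above (b i j) (c i) := (q i).span.above _ ⟨j, rfl⟩
  have h2 : T.Above (b i' j') (c i') := (q i').span.above _ ⟨j', rfl⟩
  have h' : b i j = b i' j' := h
  rw [← h'] at h2
  obtain rfl := p.injective (p.span.eq_of_above _ ⟨i, rfl⟩ _ ⟨i', rfl⟩ _ h1 h2)
  rw [(q i).injective h']

/-- The free coloured symmetric operad `Ω(T)` generated by the vertices of the tree `T`; its
colours are the edges of `T`. -/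
def operad (T : OmegaTree) : Operad where
  Color := T.E
  Op c x := T.TreeOp c x
  id x := ⟨fun _ _ _ => rfl, (Span.edge x).of_eq (by simp)⟩
  relabel := by
    intro I J _ _ c c' x e h p
    obtain rfl : c = c' ∘ e := funext fun i => (h i).symm
    exact ⟨(Equiv.injective_comp e c').1 p.injective,
      p.span.of_eq (EquivLike.range_comp c' e)⟩
  comp p q := ⟨comp_injective p q, comp_range p q⟩
  relabel_refl _ := Subsingleton.elim _ _
  relabel_trans _ _ _ _ _ := Subsingleton.elim _ _
  comp_relabel_left _ _ _ := Subsingleton.elim _ _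
  comp_relabel_right _ _ _ _ := Subsingleton.elim _ _
  id_comp _ := Subsingleton.elim _ _
  comp_id _ := Subsingleton.elim _ _
  assoc _ _ _ := Subsingleton.elim _ _

/-- The category `Ω` of trees: morphisms `S ⟶ T` are the morphisms of operads `Ω(S) ⟶ Ω(T)`. -/
instance : Category OmegaTree where
  Hom S T := S.operad ⟶ T.operad
  id T := 𝟙 T.operad
  comp F G := CategoryStruct.comp (obj := Operad) F G

/-- An edge is a leaf if it is not the outgoing edge of a vertex. -/
def IsLeaf (T : OmegaTree) (e : T.E) : Prop := ∀ v, T.out v ≠ e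

/-- An edge is inner if it is neither the root nor a leaf. -/
def IsInner (T : OmegaTree) (e : T.E) : Prop := e ≠ T.root ∧ ¬ T.IsLeaf e

/-- A top vertex: all its inputs (if any) are leaves. -/
def IsTop (T : OmegaTree) (v : T.V) : Prop := ∀ e ∈ T.inp v, T.IsLeaf e

/-- The root vertex: its outgoing edge is the root edge. -/
def IsRootVertex (T : OmegaTree) (r : T.V) : Prop := T.out r = T.root

/-- A tree is open if it has no bald (nullary) vertices. -/
def IsOpen (T : OmegaTree) : Prop := ∀ v, (T.inp v).Nonempty

/-- A corolla: a tree with exactly one vertex. -/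
def IsCorolla (T : OmegaTree) : Prop := ∃ v : T.V, ∀ w : T.V, w = v

/-! ### Elementary faces -/

/-- The morphism of `Ω` given by an injective map on edges that sends every vertex (with its
inputs and output) to a subtree. -/
def homOfInjective {S T : OmegaTree} (f : S.E → T.E) (hf : Function.Injective f)
    (h : ∀ v, T.Span (f '' S.inp v) (f (S.out v))) : S ⟶ T where
  onColor := f
  onOp := fun {I} _ {c} {x} p => ⟨hf.comp p.injective, by
    have key : ∀ {L : Set S.E} {e : S.E}, S.Span L e → T.Span (f '' L) (f e) := by
      intro L e hL
      induction hL with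
      | edge e => exact (Span.edge (f e)).of_eq (by simp)
      | graft v L _ ih =>
        refine ((h v).bind (fun l => ⋃ e : { e // f e = l }, f '' L e.1) ?_).of_eq ?_
        · rintro _ ⟨e, he, rfl⟩
          refine (ih e he).of_eq ?_
          ext y
          simp only [Set.mem_iUnion]
          constructor
          · intro hy
            exact ⟨⟨e, rfl⟩, hy⟩
          · rintro ⟨⟨k, hk⟩, hy⟩
            obtain rfl := hf hk
            exact hy
        · ext y
          simp only [Set.mem_iUnion, Set.mem_image]
          constructor
          · rintro ⟨_, ⟨e, he, rfl⟩, ⟨k, hk⟩, z, hz, rfl⟩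
            obtain rfl := hf hk
            exact ⟨z, ⟨k, he, hz⟩, rfl⟩
          · rintro ⟨z, ⟨e, he, hz⟩, rfl⟩
            exact ⟨f e, ⟨e, he, rfl⟩, ⟨e, rfl⟩, z, hz, rfl⟩
    exact (key p.span).of_eq (Set.range_comp f c).symm⟩
  map_id _ := Subsingleton.elim (α := T.TreeOp _ _) _ _
  map_relabel _ _ _ := Subsingleton.elim (α := T.TreeOp _ _) _ _
  map_comp _ _ := Subsingleton.elim (α := T.TreeOp _ _) _ _

/-- The tree obtained by contracting a non-root edge `x` (for an inner edge `x`, the vertex with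
outgoing edge `x` is merged into the vertex with input `x`). -/
def contract (T : OmegaTree) (x : T.E) (hx : x ≠ T.root) : OmegaTree where
  E := { e : T.E // e ≠ x }
  V := { u : T.V // T.out u ≠ x }
  finite_E := by have := T.finite_E; infer_instance
  out u := ⟨T.out u.1, u.2⟩
  inp u := { e | e.1 ∈ T.inp u.1 ∨ (x ∈ T.inp u.1 ∧ ∃ w, T.out w = x ∧ e.1 ∈ T.inp w) }
  root := ⟨T.root, hx.symm⟩
  out_injective := fun u v h => Subtype.ext (T.out_injective (congrArg Subtype.val h))
  inp_unique := by
    rintro e ⟨u, hu⟩ ⟨v, hv⟩ (h | ⟨h, w, hw, h'⟩) (k | ⟨k, w', hw', k'⟩)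
    · exact Subtype.ext (T.inp_unique h k)
    · exact (hu ((congrArg T.out (T.inp_unique h k')).trans hw')).elim
    · exact (hv ((congrArg T.out (T.inp_unique k h')).trans hw)).elim
    · exact Subtype.ext (T.inp_unique h k)
  root_notMem := by
    rintro u (h | ⟨-, w, -, h⟩)
    · exact T.root_notMem _ h
    · exact T.root_notMem _ h
  reach_root := by
    have key : ∀ e, (∀ h : e ≠ x, Relation.ReflTransGen
        (fun a b : { e : T.E // e ≠ x } => ∃ v : { u : T.V // T.out u ≠ x },
          (a.1 ∈ T.inp v.1 ∨ (x ∈ T.inp v.1 ∧ ∃ w, T.out w = x ∧ a.1 ∈ T.inp w)) ∧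
            (⟨T.out v.1, v.2⟩ : { e : T.E // e ≠ x }) = b) ⟨e, h⟩ ⟨T.root, hx.symm⟩) ∧
        (e = x → ∃ v, x ∈ T.inp v ∧ ∃ h : T.out v ≠ x, Relation.ReflTransGen
        (fun a b : { e : T.E // e ≠ x } => ∃ v : { u : T.V // T.out u ≠ x },
          (a.1 ∈ T.inp v.1 ∨ (x ∈ T.inp v.1 ∧ ∃ w, T.out w = x ∧ a.1 ∈ T.inp w)) ∧
            (⟨T.out v.1, v.2⟩ : { e : T.E // e ≠ x }) = b) ⟨T.out v, h⟩ ⟨T.root, hx.symm⟩) := by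
      intro e
      refine Relation.ReflTransGen.head_induction_on (T.reach_root e) ?_ ?_
      · exact ⟨fun _ => .refl, fun h => (hx h.symm).elim⟩
      · rintro a _ ⟨v, hv, rfl⟩ _ ⟨ih1, ih2⟩
        refine ⟨fun ha => ?_, ?_⟩
        · by_cases hvx : T.out v = x
          · obtain ⟨w, hw, hwx, hr⟩ := ih2 hvx
            exact .head ⟨⟨w, hwx⟩, Or.inr ⟨hw, v, hvx, hv⟩, rfl⟩ hr
          · exact .head ⟨⟨v, hvx⟩, Or.inl hv, rfl⟩ (ih1 hvx)
        · rintro rfl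
          have hne : T.out v ≠ a := fun h =>
            T.acyclic a (Relation.TransGen.single ⟨v, hv, h⟩)
          exact ⟨v, hv, hne, ih1 hne⟩
    exact fun e => (key e.1).1 e.2

/-- The inner face map: the inclusion of the tree with the inner edge `x` contracted. -/
def contractMap (T : OmegaTree) (x : T.E) (hx : T.IsInner x) : T.contract x hx.1 ⟶ T :=
  homOfInjective (fun e => e.1) Subtype.val_injective (by
    classical
    obtain ⟨w, hw⟩ := not_forall_not.1 hx.2
    rintro ⟨u, hu⟩
    refine (Span.graft u (fun e => if e = x then T.inp w else {e}) ?_).of_eq ?_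
    · intro e _
      by_cases he : e = x
      · subst he
        simpa [hw] using Span.vertex T w
      · simpa [he] using Span.edge e
    · ext y
      simp only [Set.mem_iUnion, Set.mem_image]
      constructor
      · rintro ⟨e, he, hy⟩
        by_cases hex : e = x
        · subst hex
          rw [if_pos rfl] at hy
          have hyx : y ≠ e := by
            rintro rfl
            exact T.acyclic y (Relation.TransGen.single ⟨w, hy, hw⟩)
          exact ⟨⟨y, hyx⟩, Or.inr ⟨he, w, hw, hy⟩, rfl⟩
        · rw [if_neg hex] at hy
          obtain rfl : y = e := hy
          exact ⟨⟨y, hex⟩, Or.inl he, rfl⟩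
      · rintro ⟨⟨z, hz⟩, (h | ⟨h, w', hw', h'⟩), rfl⟩
        · exact ⟨z, h, by simp [hz]⟩
        · obtain rfl := T.out_injective (hw'.trans hw.symm)
          exact ⟨x, h, by simpa using h'⟩)

/-- The tree obtained by removing a top vertex together with its inputs. -/
def chop (T : OmegaTree) (v : T.V) (hv : T.IsTop v) : OmegaTree where
  E := { e : T.E // e ∉ T.inp v }
  V := { u : T.V // u ≠ v }
  finite_E := by have := T.finite_E; infer_instance
  out u := ⟨T.out u.1, fun h => hv _ h u.1 rfl⟩
  inp u := { e | e.1 ∈ T.inp u.1 }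
  root := ⟨T.root, T.root_notMem v⟩
  out_injective := fun u w h => Subtype.ext (T.out_injective (congrArg Subtype.val h))
  inp_unique := fun h k => Subtype.ext (T.inp_unique h k)
  root_notMem := fun u => T.root_notMem u.1
  reach_root := by
    rintro ⟨e, he⟩
    revert he
    refine Relation.ReflTransGen.head_induction_on (T.reach_root e) ?_ ?_
    · exact fun _ => .refl
    · rintro a _ ⟨u, hu, rfl⟩ _ ih ha
      have huv : u ≠ v := by rintro rfl; exact ha hu
      exact .head ⟨⟨u, huv⟩, hu, rfl⟩ (ih (fun h => hv _ h u rfl))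

/-- The top face map: the inclusion of the tree with the top vertex `v` removed. -/
def chopMap (T : OmegaTree) (v : T.V) (hv : T.IsTop v) : T.chop v hv ⟶ T :=
  homOfInjective (fun e => e.1) Subtype.val_injective (by
    rintro ⟨u, hu⟩
    refine (Span.vertex T u).of_eq ?_
    ext y
    constructor
    · intro hy
      exact ⟨⟨y, fun h => hu (T.inp_unique hy h)⟩, hy, rfl⟩
    · rintro ⟨z, hz, rfl⟩
      exact hz)

/-- The subtree `T/z` of `T` consisting of everything above the edge `z`, with root edge `z`. -/
def upper (T : OmegaTree) (z : T.E) : OmegaTree where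
  E := { e : T.E // T.Above e z }
  V := { u : T.V // T.Above (T.out u) z }
  finite_E := by have := T.finite_E; infer_instance
  out u := ⟨T.out u.1, u.2⟩
  inp u := { e | e.1 ∈ T.inp u.1 }
  root := ⟨z, Relation.ReflTransGen.refl⟩
  out_injective := fun u w h => Subtype.ext (T.out_injective (congrArg Subtype.val h))
  inp_unique := fun h k => Subtype.ext (T.inp_unique h k)
  root_notMem := fun u h => T.acyclic z (Relation.TransGen.head' ⟨u.1, h, rfl⟩ u.2)
  reach_root := by
    rintro ⟨e, he⟩
    refine Relation.ReflTransGen.head_induction_on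
      (motive := fun a h => Relation.ReflTransGen
        (fun a b : { e : T.E // T.Above e z } => ∃ v : { u : T.V // T.Above (T.out u) z },
          a.1 ∈ T.inp v.1 ∧ (⟨T.out v.1, v.2⟩ : { e : T.E // T.Above e z }) = b)
          ⟨a, h⟩ ⟨z, Relation.ReflTransGen.refl⟩) he ?_ ?_
    · exact .refl
    · rintro a _ ⟨u, hu, rfl⟩ hc ih
      exact .head ⟨⟨u, hc⟩, hu, rfl⟩ ih

/-- The inclusion of `T/z` into `T`. -/
def upperMap (T : OmegaTree) (z : T.E) : T.upper z ⟶ T :=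
  homOfInjective (fun e => e.1) Subtype.val_injective (by
    rintro ⟨u, hu⟩
    refine (Span.vertex T u).of_eq ?_
    ext y
    constructor
    · intro hy
      exact ⟨⟨y, Relation.ReflTransGen.head ⟨u, hy, rfl⟩ hu⟩, hy, rfl⟩
    · rintro ⟨z, hz, rfl⟩
      exact hz)

/-- The tree with one edge and no vertices. -/
def eta : OmegaTree where
  E := Unit
  V := Empty
  finite_E := inferInstance
  out := Empty.elim
  inp := Empty.elim
  root := ()
  out_injective := fun v => v.elim
  inp_unique := fun {_} {v} => v.elim
  root_notMem := fun v => v.elim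
  reach_root := fun _ => .refl

/-- The inclusion of an edge. -/
def edgeMap (T : OmegaTree) (e : T.E) : eta ⟶ T :=
  homOfInjective (fun _ => e) (fun _ _ _ => rfl) (fun v => v.elim)

/-- The indices of the elementary faces of a tree `T`: an inner edge, a top vertex, the root
vertex if exactly one inner edge is attached to it, and, if `T` is a corolla, any edge. -/
inductive FaceIndex (T : OmegaTree) : Type
  | inner (x : T.E) (hx : T.IsInner x) : FaceIndex T
  | top (v : T.V) (hv : T.IsTop v) : FaceIndex T
  | root (r : T.V) (hr : T.IsRootVertex r) (x : T.E) (hx : x ∈ T.inp r) (hi : T.IsInner x)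
      (hu : ∀ e ∈ T.inp r, T.IsInner e → e = x) : FaceIndex T
  | edge (h : T.IsCorolla) (e : T.E) : FaceIndex T

/-- The tree `∂_x T`. -/
def FaceIndex.tree {T : OmegaTree} : T.FaceIndex → OmegaTree
  | .inner x hx => T.contract x hx.1
  | .top v hv => T.chop v hv
  | .root _ _ x _ _ _ => T.upper x
  | .edge _ _ => eta

/-- The face map `∂_x T ⟶ T`. -/
def FaceIndex.map {T : OmegaTree} : (x : T.FaceIndex) → (x.tree ⟶ T)
  | .inner x hx => T.contractMap x hx
  | .top v hv => T.chopMap v hv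
  | .root _ _ x _ _ _ => T.upperMap x
  | .edge _ e => T.edgeMap e

end OmegaTree

/-! ### Dendroidal sets and their tensor product -/

/-- The dendroidal set `Ω[T]` represented by a tree `T`. -/
abbrev rep (T : OmegaTree) : OmegaTreeᵒᵖ ⥤ Type 1 := yoneda.obj T

/-- The functor from trees to operads, `T ↦ Ω(T)`. -/
def operadFunctor : OmegaTree ⥤ Operad where
  obj T := T.operad
  map F := F

/-- The dendroidal nerve of an operad. -/
def nerve : Operad ⥤ OmegaTreeᵒᵖ ⥤ Type 1 :=
  yoneda ⋙ (Functor.whiskeringLeft _ _ _).obj operadFunctor.op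

/-- The tensor product `S ⊗ T = Ω[S] ⊗ Ω[T]`: the nerve of the Boardman-Vogt tensor product of
`Ω(S)` and `Ω(T)`. -/
noncomputable def tensor (S T : OmegaTree) : OmegaTreeᵒᵖ ⥤ Type 1 :=
  nerve.obj (BV S.operad T.operad)

/-- Functoriality of `S ⊗ T` in the trees `S` and `T`. -/
noncomputable def tensorMap {S S' T T' : OmegaTree} (f : S' ⟶ S) (g : T' ⟶ T) :
    tensor S' T' ⟶ tensor S T :=
  nerve.map (BV.map (operadFunctor.map f) (operadFunctor.map g))

/-- For dendroidal subsets `A ⊆ Ω[S]` and `B ⊆ Ω[T]`, the dendroidal subset `A ⊗ B` of `S ⊗ T`.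
As `⊗` preserves colimits in each variable and `A`, `B` are the colimits of their elements
`S' ⟶ S`, `T' ⟶ T`, the image of the canonical map `A ⊗ B ⟶ Ω[S] ⊗ Ω[T]` is the union of the
images of the corresponding maps `S' ⊗ T' ⟶ S ⊗ T`. -/
noncomputable def tensorSub {S T : OmegaTree} (A : Subfunctor (rep S)) (B : Subfunctor (rep T)) :
    Subfunctor (tensor S T) :=
  ⨆ (S' : OmegaTree) (T' : OmegaTree) (f : A.obj (Opposite.op S')) (g : B.obj (Opposite.op T')),
    Subfunctor.range (tensorMap (S := S) (S' := S') (T := T) (T' := T') f.1 g.1)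

/-- The elementary face `∂_x T` as a dendroidal subset of `Ω[T]`. -/
def face {T : OmegaTree} (x : T.FaceIndex) : Subfunctor (rep T) :=
  Subfunctor.range (yoneda.map x.map)

end Dendroidal

namespace Dendroidal

namespace OmegaTree

/-! For open `S`, the quotient defining `Ω(S) ⊗ Ω(T)` can be replaced by a combinatorial condition:
there is at most one operation with inputs `c` and output `x`, and there is one exactly when `c` is
a `Shuffle` over `x` (`shuffle_of_op`, `bv_op_unique`, `Shuffle.nonempty_op`). A dendrex of `S ⊗ T`
is therefore just a map on colours that sends operations to shuffles (`bv_hom_ext`,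
`exists_hom_of_shuffle`), and both equalities become statements about colours. In each, one
inclusion is monotonicity.

Existence and uniqueness are proved by induction on the output colour. Every operation is an
identity or has a bottom generator, a vertex of `S` or of `T` (`rootForm`). That generator is not
unique because of the interchange relation, but the inputs determine one that can be chosen: if no
input has the `T`-colour of the output, a vertex of `T` can be moved to the bottom
(`isGraft_bvRight`); if some input has it, the bottom must be a vertex of `S` (`isGraft_bvLeft`).
The inputs then also determine how they are distributed over the generator.

For (i), the lifts of a dendrex to `S ⊗ ∂_yT` and `S ⊗ ∂_zT` have to be factored through one tree
over both faces. That tree has as edges the `T`-colours occurring in the dendrex. What remains is to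
decide which edges carry a vertex: those `e` for which every leaf of either face above `e` lies
above a further occurring edge strictly above `e` (`exists_common_lift`). About the faces only the
injectivity of the face maps is used.

For (ii), the `S`-colour is taken from the lift to `∂_xS ⊗ T` and the `T`-colour from the lift to `S
⊗ ∂_yT`. The only delicate condition is covering: a leaf of `∂_yT` need not be a leaf of `T`, but
openness of `T` provides a leaf of `T` above it. -/

instance (T : OmegaTree) : Finite T.E := T.finite_E

/-! ### The order on the edges of a tree, and subtrees as antichains -/

theorem Above.antisymm {T : OmegaTree} {a b : T.E} (h : T.Above a b) (h' : T.Above b a) :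
    a = b := by
  rcases Relation.ReflTransGen.cases_head h with h | ⟨c, hac, hcb⟩
  · exact h
  · exact (T.acyclic a (Relation.TransGen.head' hac (hcb.trans h'))).elim

theorem Above.total {T : OmegaTree} {a b c : T.E} (h : T.Above a b) (h' : T.Above a c) :
    T.Above b c ∨ T.Above c b :=
  Relation.ReflTransGen.total_of_right_unique T.step_unique h h'

theorem Above.exists_input {T : OmegaTree} {a : T.E} {v : T.V} (h : T.Above a (T.out v))
    (hne : a ≠ T.out v) : ∃ b ∈ T.inp v, T.Above a b := by
  rcases Relation.ReflTransGen.cases_tail h with h | ⟨b, hab, w, hw, hwv⟩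
  · exact (hne h.symm).elim
  · obtain rfl := T.out_injective hwv
    exact ⟨b, hw, hab⟩

theorem IsLeaf.eq_of_above {T : OmegaTree} {a e : T.E} (he : T.IsLeaf e) (h : T.Above a e) :
    a = e := by
  rcases Relation.ReflTransGen.cases_tail h with h | ⟨b, -, w, -, hw⟩
  · exact h.symm
  · exact (he w hw).elim

theorem above_of_mem_inp {T : OmegaTree} {a : T.E} {v : T.V} (h : a ∈ T.inp v) :
    T.Above a (T.out v) := Relation.ReflTransGen.single ⟨v, h, rfl⟩

theorem out_ne_of_mem_inp {T : OmegaTree} {a : T.E} {v : T.V} (h : a ∈ T.inp v) :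
    T.out v ≠ a := fun h' => T.acyclic a (Relation.TransGen.single ⟨v, h, h'⟩)

theorem input_unique {T : OmegaTree} {a b b' : T.E} {v : T.V} (hb : b ∈ T.inp v)
    (hb' : b' ∈ T.inp v) (h : T.Above a b) (h' : T.Above a b') : b = b' := by
  rcases h.total h' with h | h
  · exact inp_eq_of_above hb hb' h
  · exact (inp_eq_of_above hb' hb h).symm

/-- `T.StrictAbove a b`: the edge `a` lies above `b` and differs from it. -/
def StrictAbove (T : OmegaTree) (a b : T.E) : Prop := T.Above a b ∧ a ≠ b

instance (T : OmegaTree) : IsTrans T.E T.StrictAbove :=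
  ⟨fun _ _ _ h h' => ⟨h.1.trans h'.1, by rintro rfl; exact h.2 (h.1.antisymm h'.1)⟩⟩

instance (T : OmegaTree) : Std.Irrefl T.StrictAbove := ⟨fun _ h => h.2 rfl⟩

theorem strictAbove_wf (T : OmegaTree) : WellFounded T.StrictAbove :=
  Finite.wellFounded_of_trans_of_irrefl _

theorem flip_strictAbove_wf (T : OmegaTree) : WellFounded (fun a b => T.StrictAbove b a) :=
  haveI : IsTrans T.E (fun a b => T.StrictAbove b a) := ⟨fun _ _ _ h h' => _root_.trans h' h⟩
  haveI : Std.Irrefl (fun a b => T.StrictAbove b a) := ⟨fun _ h => h.2 rfl⟩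
  Finite.wellFounded_of_trans_of_irrefl _

/-- Induction from the leaves to the root. -/
theorem inp_induction (T : OmegaTree) {motive : T.E → Prop}
    (h : ∀ e, (∀ v, T.out v = e → ∀ a ∈ T.inp v, motive a) → motive e) (e : T.E) : motive e :=
  T.strictAbove_wf.induction e fun e ih => h e fun _ hv a ha =>
    ih a ⟨hv ▸ above_of_mem_inp ha, fun h => out_ne_of_mem_inp ha (hv.trans h.symm)⟩

theorem IsOpen.exists_leaf {T : OmegaTree} (hT : T.IsOpen) (e : T.E) :
    ∃ l, T.IsLeaf l ∧ T.Above l e := by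
  induction e using T.inp_induction with | h e ih => ?_
  by_cases he : T.IsLeaf e
  · exact ⟨e, he, .refl⟩
  · obtain ⟨v, rfl⟩ := not_forall_not.1 he
    obtain ⟨a, ha⟩ := hT v
    obtain ⟨l, hl, hla⟩ := ih v rfl a ha
    exact ⟨l, hl, hla.trans (above_of_mem_inp ha)⟩

/-- Two edges are comparable if one lies above the other. -/
def Comparable (T : OmegaTree) (a b : T.E) : Prop := T.Above a b ∨ T.Above b a

/-- The upper one of `a`, `b` lies above both `a'` and `b'`, and the edges below a given edge form a
chain. -/
theorem Comparable.of_above {T : OmegaTree} {a b a' b' : T.E} (h : T.Comparable a b)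
    (ha : T.Above a a') (hb : T.Above b b') : T.Comparable a' b' := by
  rcases h with h | h
  · exact ha.total (h.trans hb)
  · exact Above.total (Relation.ReflTransGen.trans h ha) hb

theorem Span.cover {T : OmegaTree} {L : Set T.E} {e : T.E} (h : T.Span L e) :
    ∀ m, T.IsLeaf m → T.Above m e → ∃ l ∈ L, T.Above m l := by
  induction h with
  | edge e => exact fun _ _ hm => ⟨e, rfl, hm⟩
  | graft v L _ ih =>
    intro m hm hmv
    obtain ⟨b, hb, hmb⟩ := hmv.exists_input (fun h => hm v h.symm)
    obtain ⟨l, hl, hml⟩ := ih b hb m hm hmb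
    exact ⟨l, Set.mem_biUnion hb hl, hml⟩

/-- An antichain of edges above `e` that meets every path from a leaf to `e` is the set of leaves
of a subtree with root `e`. -/
theorem span_of_cover {T : OmegaTree} (e : T.E) : ∀ (L : Set T.E), (∀ l ∈ L, T.Above l e) →
    (∀ l ∈ L, ∀ l' ∈ L, T.Above l l' → l = l') →
    (∀ m, T.IsLeaf m → T.Above m e → ∃ l ∈ L, T.Above m l) → T.Span L e := by
  induction e using T.inp_induction with | h e ih => ?_
  intro L habove hanti hcover
  by_cases he : e ∈ L
  · refine (Span.edge e).of_eq ?_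
    ext l
    exact ⟨fun h => h ▸ he, fun h => hanti l h e he (habove l h)⟩
  · have hleaf : ¬ T.IsLeaf e := by
      intro hl
      obtain ⟨l, hlL, hel⟩ := hcover e hl .refl
      exact he (hel.antisymm (habove l hlL) ▸ hlL)
    obtain ⟨w, rfl⟩ := not_forall_not.1 hleaf
    -- Every `l` in `L` lies above exactly one input of `w`; the induction hypothesis applies to
    -- each of these parts of `L`.
    refine (Span.graft w (fun b => {l ∈ L | T.Above l b}) fun b hb => ?_).of_eq ?_
    · refine ih w rfl b hb _ (fun l hl => hl.2) (fun l hl l' hl' => hanti l hl.1 l' hl'.1) ?_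
      intro m hm hmb
      obtain ⟨l, hl, hml⟩ := hcover m hm (hmb.trans (above_of_mem_inp hb))
      obtain ⟨b', hb', hlb'⟩ := (habove l hl).exists_input (fun h => he (h ▸ hl))
      obtain rfl := input_unique hb hb' hmb (hml.trans hlb')
      exact ⟨l, ⟨hl, hlb'⟩, hml⟩
    · ext l
      simp only [Set.mem_iUnion, Set.mem_ofPred_eq, exists_prop]
      constructor
      · rintro ⟨_, _, h, _⟩
        exact h
      · intro hl
        obtain ⟨b, hb, hlb⟩ := (habove l hl).exists_input (fun h => he (h ▸ hl))
        exact ⟨b, hb, hl, hlb⟩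

/-- The operation of `Ω(T)` given by a vertex. -/
def vertexOp (T : OmegaTree) (v : T.V) :
    T.operad.Op (fun a : T.inp v => (a.1 : T.E)) (T.out v) :=
  (⟨Subtype.val_injective, (Span.vertex T v).of_eq Subtype.range_coe.symm⟩ :
    T.TreeOp (fun a : T.inp v => (a.1 : T.E)) (T.out v))

theorem above_of_hom {S T : OmegaTree} (F : S ⟶ T) {a b : S.E} (h : S.Above a b) :
    T.Above (F.onColor a) (F.onColor b) := by
  induction h with
  | refl => exact .refl
  | tail _ h ih =>
    obtain ⟨v, hv, rfl⟩ := h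
    have p : T.TreeOp _ _ := F.onOp (S.vertexOp v)
    exact ih.trans (p.span.above _ ⟨⟨_, hv⟩, rfl⟩)

/-- Climbing from the root towards `b`: once `a` is known to lie above the output of a vertex, it
lies above one of its inputs. The inputs map to leaves of a subtree, which are pairwise
incomparable, so the input has to be the one leading to `b`. -/
theorem above_of_above_hom {S T : OmegaTree} (F : S ⟶ T) (hF : Function.Injective F.onColor)
    {a b : S.E} (h : T.Above (F.onColor a) (F.onColor b)) : S.Above a b := by
  revert h
  refine Relation.ReflTransGen.head_induction_on
    (motive := fun b _ => T.Above (F.onColor a) (F.onColor b) → S.Above a b) (S.reach_root b) ?_ ?_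
  · exact fun _ => S.reach_root a
  · rintro b _ ⟨v, hv, rfl⟩ _ ih h
    have p : T.TreeOp _ _ := F.onOp (S.vertexOp v)
    have hb : T.Above (F.onColor b) (F.onColor (S.out v)) := above_of_hom F (above_of_mem_inp hv)
    have hav := ih (h.trans hb)
    by_cases hne : a = S.out v
    · subst hne
      exact (out_ne_of_mem_inp hv (hF (h.antisymm hb))).elim
    · obtain ⟨b', hb', hab'⟩ := hav.exists_input hne
      have := p.span.eq_of_above _ ⟨⟨b, hv⟩, rfl⟩ _ ⟨⟨b', hb'⟩, rfl⟩ _ h (above_of_hom F hab')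
      obtain rfl : b = b' := hF this
      exact hab'

theorem hom_ext {S T : OmegaTree} {F G : S ⟶ T} (h : ∀ e, F.onColor e = G.onColor e) :
    F = G := by
  obtain ⟨f, fo, _, _, _⟩ := F
  obtain ⟨g, go, _, _, _⟩ := G
  obtain rfl : f = g := funext h
  refine Operad.Hom.ext rfl (heq_of_eq ?_)
  funext I _ c x p
  exact Subsingleton.elim (α := T.TreeOp _ _) _ _

end OmegaTree

/-! ### Shuffles: a necessary condition on the inputs of an operation -/

open OmegaTree

/-- The condition on the inputs `c` of an operation of `Ω(S) ⊗ Ω(T)` with output `x`: they lie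
above `x`, no two of them lie on a common pair of branches of `S` and `T`, and some input lies on
every pair of branches from a leaf of `S` and a leaf of `T` to `x`. -/
structure Shuffle (S T : OmegaTree) {I : Type} (c : I → S.E × T.E) (x : S.E × T.E) : Prop where
  above_left : ∀ i, S.Above (c i).1 x.1
  above_right : ∀ i, T.Above (c i).2 x.2
  eq_of_comparable : ∀ i j, S.Comparable (c i).1 (c j).1 → T.Comparable (c i).2 (c j).2 → i = j
  cover : ∀ l m, S.IsLeaf l → T.IsLeaf m → S.Above l x.1 → T.Above m x.2 →
    ∃ i, S.Above l (c i).1 ∧ T.Above m (c i).2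

theorem OmegaTree.TreeOp.eq_of_comparable {T : OmegaTree} {I : Type} {c : I → T.E} {x : T.E}
    (p : T.TreeOp c x) {i j : I} (h : T.Comparable (c i) (c j)) : i = j := by
  refine p.injective ?_
  rcases h with h | h
  · exact p.span.eq_of_above _ ⟨i, rfl⟩ _ ⟨j, rfl⟩ _ .refl h
  · exact p.span.eq_of_above _ ⟨i, rfl⟩ _ ⟨j, rfl⟩ _ h .refl

/-- The generators satisfy the condition by the corresponding facts about subtrees of one tree, and
it is stable under relabelling and composition. As it only concerns the inputs and the output,
nothing has to be checked for the relations. -/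
theorem BVTerm.shuffle {S T : OmegaTree} {I : Type}
    {c : I → S.operad.Color × T.operad.Color} {x : S.operad.Color × T.operad.Color}
    (t : BVTerm S.operad T.operad c x) : Shuffle S T c x := by
  induction t with
  | @left I _ a a' p d =>
    have p : S.TreeOp a a' := p
    refine ⟨fun i => p.span.above _ ⟨i, rfl⟩, fun i => .refl, fun i j h _ => p.eq_of_comparable h,
      fun l m hl hm hlx hmx => ?_⟩
    obtain ⟨_, ⟨i, rfl⟩, h⟩ := p.span.cover l hl hlx
    exact ⟨i, h, hmx⟩
  | @right I _ a a' d p =>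
    have p : T.TreeOp a a' := p
    refine ⟨fun i => .refl, fun i => p.span.above _ ⟨i, rfl⟩, fun i j _ h => p.eq_of_comparable h,
      fun l m hl hm hlx hmx => ?_⟩
    obtain ⟨_, ⟨i, rfl⟩, h⟩ := p.span.cover m hm hmx
    exact ⟨i, hlx, h⟩
  | id x =>
    exact ⟨fun _ => .refl, fun _ => .refl, fun _ _ _ _ => rfl, fun _ _ _ _ h h' => ⟨(), h, h'⟩⟩
  | @relabel I J c c' x e h t ih =>
    obtain rfl : c = c' ∘ e := funext fun i => (h i).symm
    refine ⟨e.forall_congr_right.1 ih.above_left, e.forall_congr_right.1 ih.above_right, ?_, ?_⟩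
    · intro i j
      obtain ⟨i, rfl⟩ := e.surjective i
      obtain ⟨j, rfl⟩ := e.surjective j
      exact fun h h' => congrArg e (ih.eq_of_comparable i j h h')
    · intro l m hl hm h h'
      obtain ⟨i, hi⟩ := ih.cover l m hl hm h h'
      exact ⟨e i, hi⟩
  | @comp I J c b x t u ih ih' =>
    refine ⟨fun s => ((ih' s.1).above_left s.2).trans (ih.above_left s.1),
      fun s => ((ih' s.1).above_right s.2).trans (ih.above_right s.1), ?_, ?_⟩
    · rintro ⟨i, j⟩ ⟨i', j'⟩ h h'
      obtain rfl : i = i' := ih.eq_of_comparable i i'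
        (h.of_above ((ih' i).above_left j) ((ih' i').above_left j'))
        (h'.of_above ((ih' i).above_right j) ((ih' i').above_right j'))
      rw [(ih' i).eq_of_comparable j j' h h']
    · intro l m hl hm h h'
      obtain ⟨i, hi, hi'⟩ := ih.cover l m hl hm h h'
      obtain ⟨j, hj⟩ := (ih' i).cover l m hl hm hi hi'
      exact ⟨⟨i, j⟩, hj⟩

/-- Formal composites carry no finiteness assumption on intermediate input sets; this recovers it
when a composite is read as an operation of `BV P Q`. -/
theorem BVTerm.finite {P Q : Operad} {I : Type} {c : I → P.Color × Q.Color}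
    {x : P.Color × Q.Color} (t : BVTerm P Q c x) : Finite I := by
  induction t with
  | left => assumption
  | right => assumption
  | id => infer_instance
  | relabel e _ _ ih => exact Finite.of_equiv _ e
  | comp _ _ ih ih' => infer_instance

/-! ### Relabelling and grafting in an arbitrary operad -/

namespace Operad

variable {W : Operad}

theorem relabel_congr {I J : Type} [Finite I] [Finite J] {c : I → W.Color} {c' : J → W.Color}
    {x : W.Color} {e e' : I ≃ J} (he : ∀ i, e i = e' i) (h : ∀ i, c' (e i) = c i)
    (h' : ∀ i, c' (e' i) = c i) (p : W.Op c x) : W.relabel e h p = W.relabel e' h' p := by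
  obtain rfl : e = e' := Equiv.ext he
  rfl

theorem eq_relabel_symm {I J : Type} [Finite I] [Finite J] {c : I → W.Color}
    {c' : J → W.Color} {x : W.Color} {e : I ≃ J} {h : ∀ i, c' (e i) = c i} {p : W.Op c x}
    {q : W.Op c' x} (hq : W.relabel e h p = q) :
    p = W.relabel e.symm (fun j => by rw [← h, e.apply_symm_apply]) q := by
  subst hq
  rw [W.relabel_trans]
  exact (W.relabel_refl p).symm.trans (relabel_congr (by simp) _ _ p)

theorem comp_relabel {I I' : Type} [Finite I] [Finite I'] {J : I' → Type} [∀ i, Finite (J i)]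
    {c : I → W.Color} {c' : I' → W.Color} {b : ∀ i, J i → W.Color} {x : W.Color} (e : I ≃ I')
    (h : ∀ i, c' (e i) = c i) (p : W.Op c x) (q : ∀ i, W.Op (b i) (c' i)) :
    W.comp (W.relabel e h p) q = W.relabel (Equiv.sigmaCongrLeft e) (fun _ => rfl)
      (W.comp p (fun i => h i ▸ q (e i))) := by
  obtain rfl : c = fun i => c' (e i) := funext fun i => (h i).symm
  exact W.comp_relabel_left e p q

theorem comp_comp {I : Type} [Finite I] {J : I → Type} [∀ i, Finite (J i)]
    {K : (Σ i, J i) → Type} [∀ s, Finite (K s)] {c : I → W.Color} {b : ∀ i, J i → W.Color}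
    {a : ∀ s, K s → W.Color} {x : W.Color} (p : W.Op c x) (q : ∀ i, W.Op (b i) (c i))
    (r : ∀ s : (Σ i, J i), W.Op (a s) (b s.1 s.2)) :
    W.comp (W.comp p q) r = W.relabel (Equiv.sigmaAssoc fun i j => K ⟨i, j⟩).symm (fun _ => rfl)
      (W.comp p fun i => W.comp (q i) fun j => r ⟨i, j⟩) :=
  eq_relabel_symm (W.assoc (K := fun i j => K ⟨i, j⟩) (a := fun i j => a ⟨i, j⟩) p q
    fun i j => r ⟨i, j⟩)

/-- `t` is obtained by grafting operations onto the inputs of `o`, where `π` sends an input of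
`t` to the input of `o` below it. -/
def IsGraft {I K : Type} [Finite I] [Finite K] {g : K → W.Color} {c : I → W.Color} {x : W.Color}
    (o : W.Op g x) (t : W.Op c x) : Prop :=
  ∃ (π : I → K) (u : ∀ k, W.Op (fun i : { i // π i = k } => c i.1) (g k)),
    t = W.relabel (Equiv.sigmaFiberEquiv π) (fun _ => rfl) (W.comp o u)

/-- The arbitrary input sets `J k` are replaced by the fibres of the map `I → K` induced by `e`.
With this normalisation two graftings onto the same `o` differ only in `π` and `u`. -/
theorem isGraft_relabel_comp {I K : Type} [Finite I] [Finite K] {J : K → Type}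
    [∀ k, Finite (J k)] {g : K → W.Color} {c : I → W.Color} {b : ∀ k, J k → W.Color}
    {x : W.Color} (o : W.Op g x) (u : ∀ k, W.Op (b k) (g k)) (e : (Σ k, J k) ≃ I)
    (h : ∀ s : (Σ k, J k), c (e s) = b s.1 s.2) :
    IsGraft o (W.relabel (c' := c) e h (W.comp o u)) := by
  let σ : ∀ k, J k ≃ { i // (e.symm i).1 = k } := fun k =>
    { toFun := fun j => ⟨e ⟨k, j⟩, by simp⟩
      invFun := fun i => i.2 ▸ (e.symm i.1).2
      left_inv := fun j => by
        -- Stated for a general `s`, so that substituting the equation makes the transport trivial.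
        have : ∀ (s : Σ k, J k) (hs : s.1 = k), s = ⟨k, j⟩ → hs ▸ s.2 = j := by
          rintro s hs rfl
          rfl
        exact this _ _ (by simp)
      right_inv := by
        rintro ⟨i, rfl⟩
        exact Subtype.ext (by simp) }
  refine ⟨fun i => (e.symm i).1, fun k => W.relabel (σ k) (fun j => h ⟨k, j⟩) (u k), ?_⟩
  rw [W.comp_relabel_right]
  have := W.relabel_trans (Equiv.sigmaCongrRight σ) (Equiv.sigmaFiberEquiv fun i => (e.symm i).1)
    (c := fun s => b s.1 s.2) (c' := fun s => c s.2.1) (c'' := c) (fun s => h s) (fun _ => rfl)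
    (W.comp o u)
  exact (relabel_congr (fun _ => rfl) _ _ _).trans this.symm

end Operad

/-! ### Generators and interchange in the Boardman-Vogt tensor product -/

section Tensor

variable {P Q : Operad}

/-- The operation `p ⊗ d` of the Boardman-Vogt tensor product. -/
def bvLeft {I : Type} [Finite I] {a : I → P.Color} {a' : P.Color} (p : P.Op a a') (d : Q.Color) :
    (BV P Q).Op (fun i => (a i, d)) (a', d) :=
  Quotient.mk (bvSetoid P Q _ _) (.left p d)

/-- The operation `c ⊗ q` of the Boardman-Vogt tensor product. -/
def bvRight {J : Type} [Finite J] {b : J → Q.Color} {b' : Q.Color} (c : P.Color) (q : Q.Op b b') :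
    (BV P Q).Op (fun j => (c, b j)) (c, b') :=
  Quotient.mk (bvSetoid P Q _ _) (.right c q)

theorem bvLeft_id (a : P.Color) (d : Q.Color) : bvLeft (P.id a) d = (BV P Q).id (a, d) :=
  Quotient.sound (BVRel.left_id a d)

theorem bvRight_id (c : P.Color) (b : Q.Color) : bvRight c (Q.id b) = (BV P Q).id (c, b) :=
  Quotient.sound (BVRel.right_id c b)

theorem bvLeft_relabel {I J : Type} [Finite I] [Finite J] {a : I → P.Color} {a' : J → P.Color}
    {x : P.Color} (e : I ≃ J) (h : ∀ i, a' (e i) = a i) (p : P.Op a x) (d : Q.Color) :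
    bvLeft (P.relabel e h p) d =
      (BV P Q).relabel e (fun i => congrArg (fun z => (z, d)) (h i)) (bvLeft p d) :=
  Quotient.sound (BVRel.left_relabel e h p d)

theorem bvRight_relabel {I J : Type} [Finite I] [Finite J] {a : I → Q.Color} {a' : J → Q.Color}
    {x : Q.Color} (e : I ≃ J) (h : ∀ i, a' (e i) = a i) (c : P.Color) (q : Q.Op a x) :
    bvRight c (Q.relabel e h q) =
      (BV P Q).relabel e (fun i => congrArg (fun z => (c, z)) (h i)) (bvRight c q) :=
  Quotient.sound (BVRel.right_relabel e h c q)

theorem bvLeft_comp {I : Type} [Finite I] {J : I → Type} [∀ i, Finite (J i)] {c : I → P.Color}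
    {b : ∀ i, J i → P.Color} {x : P.Color} (p : P.Op c x) (q : ∀ i, P.Op (b i) (c i))
    (d : Q.Color) :
    bvLeft (P.comp p q) d = (BV P Q).comp (bvLeft p d) (fun i => bvLeft (q i) d) :=
  (Quotient.sound (BVRel.left_comp p q d)).trans (bvComp_mk _ fun i => .left (q i) d).symm

theorem bvRight_comp {I : Type} [Finite I] {J : I → Type} [∀ i, Finite (J i)] {a : I → Q.Color}
    {b : ∀ i, J i → Q.Color} {x : Q.Color} (c : P.Color) (p : Q.Op a x)
    (q : ∀ i, Q.Op (b i) (a i)) :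
    bvRight c (Q.comp p q) = (BV P Q).comp (bvRight c p) (fun i => bvRight c (q i)) :=
  (Quotient.sound (BVRel.right_comp c p q)).trans (bvComp_mk _ fun i => .right c (q i)).symm

theorem bv_interchange {I J : Type} [Finite I] [Finite J] {a : I → P.Color} {a' : P.Color}
    {b : J → Q.Color} {b' : Q.Color} (p : P.Op a a') (q : Q.Op b b') :
    (BV P Q).relabel (c' := fun s : (Σ _ : J, I) => (a s.2, b s.1))
      ((Equiv.sigmaEquivProd I J).trans
        ((Equiv.prodComm I J).trans (Equiv.sigmaEquivProd J I).symm)) (fun _ => rfl)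
      ((BV P Q).comp (bvLeft p b') (fun i => bvRight (a i) q)) =
    (BV P Q).comp (bvRight a' q) (fun j => bvLeft p (b j)) := by
  refine (congrArg _ (bvComp_mk _ fun i => .right (a i) q)).trans ?_
  exact (Quotient.sound (BVRel.interchange p q)).trans (bvComp_mk _ fun j => .left p (b j)).symm

/-- This is the interchange relation with further operations grafted on top. Associativity turns
both sides into graftings onto the two-level composites that the relation identifies; the rest is
bookkeeping of bijections, of which only the existence matters later. -/
theorem bv_interchange_comp {I J : Type} [Finite I] [Finite J] {K : I → J → Type}
    [∀ i j, Finite (K i j)] {a : I → P.Color} {a' : P.Color} {b : J → Q.Color} {b' : Q.Color}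
    {γ : ∀ i j, K i j → (BV P Q).Color} (p : P.Op a a') (q : Q.Op b b')
    (u : ∀ i j, (BV P Q).Op (γ i j) (a i, b j)) :
    ∃ (e : (Σ j, Σ i, K i j) ≃ (Σ i, Σ j, K i j))
      (h : ∀ s : (Σ j, Σ i, K i j), γ (e s).1 (e s).2.1 (e s).2.2 = γ s.2.1 s.1 s.2.2),
    (BV P Q).comp (bvLeft p b') (fun i => (BV P Q).comp (bvRight (a i) q) (u i)) =
      (BV P Q).relabel (c' := fun s : (Σ i, Σ j, K i j) => γ s.1 s.2.1 s.2.2) e h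
        ((BV P Q).comp (bvRight a' q) (fun j => (BV P Q).comp (bvLeft p (b j))
          (fun i => u i j))) := by
  have h1 := (BV P Q).assoc (bvLeft p b') (fun i => bvRight (a i) q) u
  have h2 := (BV P Q).assoc (bvRight a' q) (fun j => bvLeft p (b j)) (fun j i => u i j)
  rw [← bv_interchange] at h2
  have h3 := (BV P Q).comp_relabel_left (J := fun s : (Σ _ : J, I) => K s.2 s.1)
    (c := fun s : (Σ _ : J, I) => (a s.2, b s.1)) (b := fun s => γ s.2 s.1)
    ((Equiv.sigmaEquivProd I J).trans
        ((Equiv.prodComm I J).trans (Equiv.sigmaEquivProd J I).symm))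
    ((BV P Q).comp (bvLeft p b') (fun i => bvRight (a i) q)) (fun s => u s.2 s.1)
  have h4 := Operad.eq_relabel_symm h1
  have h5 := (congrArg ((BV P Q).relabel (Equiv.sigmaAssoc fun j i => K i j) (fun _ => rfl))
    (h3.trans (congrArg ((BV P Q).relabel _ _) h4))).symm.trans h2
  exact ⟨_, _, Operad.eq_relabel_symm
    (((BV P Q).relabel_trans _ _ _ (fun _ => rfl) _).symm.trans
      (((BV P Q).relabel_trans _ _ (fun _ => rfl) (fun _ => rfl) _).symm.trans h5))⟩

end Tensor

/-! ### Every operation has a generating vertex at its root -/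

theorem OmegaTree.TreeOp.cases {T : OmegaTree} {I : Type} {c : I → T.E} {x : T.E}
    (p : T.TreeOp c x) : (∃ e : Unit ≃ I, c (e ()) = x) ∨
      ∃ (v : T.V) (π : I → T.inp v), T.out v = x ∧
        ∀ a, Nonempty (T.TreeOp (fun i : { i // π i = a } => c i.1) a) := by
  obtain ⟨hinj, hspan⟩ := p
  generalize hL : Set.range c = L at hspan
  cases hspan with
  | edge e =>
    left
    obtain ⟨i, hi⟩ : x ∈ Set.range c := hL ▸ rfl
    refine ⟨⟨fun _ => i, fun _ => (), fun _ => rfl, fun j => hinj ?_⟩, hi⟩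
    rw [hi]
    exact (hL.subset ⟨j, rfl⟩ : c j = x).symm
  | graft v L h =>
    right
    have hmem : ∀ i, ∃ a : T.inp v, c i ∈ L a := fun i => by
      have := hL.subset ⟨i, rfl⟩
      simp only [Set.mem_iUnion] at this
      obtain ⟨a, ha, hi⟩ := this
      exact ⟨⟨a, ha⟩, hi⟩
    choose π hπ using hmem
    refine ⟨v, π, rfl, fun a => ⟨⟨hinj.comp Subtype.val_injective, (h a a.2).of_eq ?_⟩⟩⟩
    ext y
    constructor
    · intro hy
      obtain ⟨i, rfl⟩ : y ∈ Set.range c := hL ▸ Set.mem_biUnion a.2 hy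
      exact ⟨⟨i, Subtype.ext (input_unique (π i).2 a.2 ((h _ (π i).2).above _ (hπ i))
        ((h a a.2).above _ hy))⟩, rfl⟩
    · rintro ⟨⟨i, rfl⟩, rfl⟩
      exact hπ i

/-- An operation of `Ω(S) ⊗ Ω(T)` is in root form if it is an identity up to relabelling, or
obtained by grafting operations onto a generator given by a vertex of `S` or of `T`. -/
inductive RootForm {S T : OmegaTree} : ∀ {I : Type} [Finite I]
    {c : I → (BV S.operad T.operad).Color} {x : (BV S.operad T.operad).Color},
    (BV S.operad T.operad).Op c x → Prop
  | id {I : Type} [Finite I] {c : I → (BV S.operad T.operad).Color}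
      {x : (BV S.operad T.operad).Color} (e : Unit ≃ I) (h : ∀ i, c (e i) = x) :
      RootForm ((BV S.operad T.operad).relabel e h ((BV S.operad T.operad).id x))
  | left {I : Type} [Finite I] {c : I → (BV S.operad T.operad).Color} (v : S.V) (d : T.E)
      {J : S.inp v → Type} [∀ a, Finite (J a)] {b : ∀ a, J a → (BV S.operad T.operad).Color}
      (e : (Σ a, J a) ≃ I) (h : ∀ s : (Σ a, J a), c (e s) = b s.1 s.2)
      (u : ∀ a : S.inp v, (BV S.operad T.operad).Op (b a) (a.1, d)) :
      RootForm ((BV S.operad T.operad).relabel e h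
        ((BV S.operad T.operad).comp (bvLeft (S.vertexOp v) d) u))
  | right {I : Type} [Finite I] {c : I → (BV S.operad T.operad).Color} (w : T.V) (s : S.E)
      {J : T.inp w → Type} [∀ a, Finite (J a)] {b : ∀ a, J a → (BV S.operad T.operad).Color}
      (e : (Σ a, J a) ≃ I) (h : ∀ s : (Σ a, J a), c (e s) = b s.1 s.2)
      (u : ∀ a : T.inp w, (BV S.operad T.operad).Op (b a) (s, a.1)) :
      RootForm ((BV S.operad T.operad).relabel e h
        ((BV S.operad T.operad).comp (bvRight s (T.vertexOp w)) u))

theorem RootForm.of_eq {S T : OmegaTree} {I : Type} [Finite I]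
    {c : I → (BV S.operad T.operad).Color} {x : (BV S.operad T.operad).Color}
    {t t' : (BV S.operad T.operad).Op c x} (h : t = t') (ht : RootForm t') : RootForm t :=
  h ▸ ht

theorem rootForm_id {S T : OmegaTree} (x : (BV S.operad T.operad).Color) :
    RootForm ((BV S.operad T.operad).id x) :=
  .of_eq ((BV S.operad T.operad).relabel_refl _).symm (.id (Equiv.refl Unit) fun _ => rfl)

theorem RootForm.relabel {S T : OmegaTree} {I J : Type} [Finite I] [Finite J]
    {c : I → (BV S.operad T.operad).Color} {c' : J → (BV S.operad T.operad).Color}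
    {x : (BV S.operad T.operad).Color} {t : (BV S.operad T.operad).Op c x} (ht : RootForm t)
    (e : I ≃ J) (h : ∀ i, c' (e i) = c i) :
    RootForm ((BV S.operad T.operad).relabel e h t) := by
  cases ht with
  | id e' h' =>
    exact .of_eq ((BV S.operad T.operad).relabel_trans _ _ _ _ _) (.id _ _)
  | left v d e' h' u =>
    exact .of_eq ((BV S.operad T.operad).relabel_trans _ _ _ _ _) (.left v d _ _ u)
  | right w s e' h' u =>
    exact .of_eq ((BV S.operad T.operad).relabel_trans _ _ _ _ _) (.right w s _ _ u)

theorem rootForm_comp_bvLeft {S T : OmegaTree} (v : S.V) (d : T.E)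
    {J : S.inp v → Type} [∀ a, Finite (J a)] {b : ∀ a, J a → (BV S.operad T.operad).Color}
    (u : ∀ a : S.inp v, (BV S.operad T.operad).Op (b a) (a.1, d)) :
    RootForm ((BV S.operad T.operad).comp (bvLeft (S.vertexOp v) d) u) :=
  .of_eq ((BV S.operad T.operad).relabel_refl _).symm
    (.left v d (b := b) (Equiv.refl _) (fun _ => rfl) u)

theorem rootForm_comp_bvRight {S T : OmegaTree} (w : T.V) (s : S.E)
    {J : T.inp w → Type} [∀ a, Finite (J a)] {b : ∀ a, J a → (BV S.operad T.operad).Color}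
    (u : ∀ a : T.inp w, (BV S.operad T.operad).Op (b a) (s, a.1)) :
    RootForm ((BV S.operad T.operad).comp (bvRight s (T.vertexOp w)) u) :=
  .of_eq ((BV S.operad T.operad).relabel_refl _).symm
    (.right w s (b := b) (Equiv.refl _) (fun _ => rfl) u)

/-- By associativity the bottom generator of `t` stays at the bottom; if `t` is an identity, the
composite is a relabelling of a single `q i`. -/
theorem RootForm.comp {S T : OmegaTree} {I : Type} [Finite I] {J : I → Type}
    [∀ i, Finite (J i)] {c : I → (BV S.operad T.operad).Color}
    {b : ∀ i, J i → (BV S.operad T.operad).Color}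
    {x : (BV S.operad T.operad).Color} {t : (BV S.operad T.operad).Op c x} (ht : RootForm t)
    {q : ∀ i, (BV S.operad T.operad).Op (b i) (c i)} (hq : ∀ i, RootForm (q i)) :
    RootForm ((BV S.operad T.operad).comp t q) := by
  cases ht with
  | id e h =>
    obtain rfl : c = fun _ => x := funext fun i => by
      obtain ⟨i, rfl⟩ := e.surjective i
      exact h i
    rw [Operad.comp_relabel]
    refine RootForm.relabel ?_ _ _
    have := (BV S.operad T.operad).id_comp (q (e ()))
    rw [Operad.eq_relabel_symm this]
    exact (hq _).relabel _ _
  | left v d e h u =>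
    refine .of_eq (Operad.comp_relabel _ _ _ _) (RootForm.relabel ?_ _ _)
    refine .of_eq (Operad.comp_comp _ _ _) ?_
    refine RootForm.relabel ?_ _ _
    exact rootForm_comp_bvLeft v d _
  | right w s e h u =>
    refine .of_eq (Operad.comp_relabel _ _ _ _) (RootForm.relabel ?_ _ _)
    refine .of_eq (Operad.comp_comp _ _ _) ?_
    refine RootForm.relabel ?_ _ _
    exact rootForm_comp_bvRight w s _

theorem rootForm_bvLeft {S T : OmegaTree} {I : Type} [Finite I] {c : I → S.operad.Color}
    {x : S.operad.Color} (p : S.operad.Op c x) (d : T.operad.Color) :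
    RootForm (S := S) (T := T) (bvLeft p d) := by
  obtain ⟨e, he⟩ | ⟨v, π, rfl, hq⟩ := TreeOp.cases (T := S) p
  · obtain rfl : p = S.operad.relabel e (fun _ => he) (S.operad.id x) :=
      Subsingleton.elim (α := S.TreeOp _ _) _ _
    refine .of_eq (bvLeft_relabel _ _ _ _) (RootForm.relabel (.of_eq (bvLeft_id _ _) ?_) _ _)
    exact rootForm_id _
  -- In a tree operad any two operations with the same inputs and output coincide, so exhibiting a
  -- composite with the right colours suffices.
  · obtain rfl : p = S.operad.relabel (Equiv.sigmaFiberEquiv π) (fun _ => rfl)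
        (S.operad.comp (S.vertexOp v) fun a => (hq a).some) :=
      Subsingleton.elim (α := S.TreeOp _ _) _ _
    refine .of_eq (bvLeft_relabel _ _ _ _) ?_
    refine RootForm.relabel ?_ _ _
    refine .of_eq (bvLeft_comp _ _ _) ?_
    exact rootForm_comp_bvLeft v d _

theorem rootForm_bvRight {S T : OmegaTree} {I : Type} [Finite I] {c : I → T.operad.Color}
    {x : T.operad.Color} (s : S.operad.Color) (p : T.operad.Op c x) :
    RootForm (S := S) (T := T) (bvRight s p) := by
  obtain ⟨e, he⟩ | ⟨v, π, rfl, hq⟩ := TreeOp.cases (T := T) p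
  · obtain rfl : p = T.operad.relabel e (fun _ => he) (T.operad.id x) :=
      Subsingleton.elim (α := T.TreeOp _ _) _ _
    refine .of_eq (bvRight_relabel _ _ _ _) (RootForm.relabel (.of_eq (bvRight_id _ _) ?_) _ _)
    exact rootForm_id _
  · obtain rfl : p = T.operad.relabel (Equiv.sigmaFiberEquiv π) (fun _ => rfl)
        (T.operad.comp (T.vertexOp v) fun a => (hq a).some) :=
      Subsingleton.elim (α := T.TreeOp _ _) _ _
    refine .of_eq (bvRight_relabel _ _ _ _) ?_
    refine RootForm.relabel ?_ _ _
    refine .of_eq (bvRight_comp _ _ _) ?_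
    exact rootForm_comp_bvRight v s _

theorem rootForm_mk {S T : OmegaTree} {I : Type} {c : I → S.operad.Color × T.operad.Color}
    {x : S.operad.Color × T.operad.Color} (t : BVTerm S.operad T.operad c x) :
    ∀ [Finite I], RootForm (S := S) (T := T) (c := c) (x := x)
      (Quotient.mk (bvSetoid S.operad T.operad c x) t) := by
  induction t with
  | left p d => exact rootForm_bvLeft p d
  | right s q => exact rootForm_bvRight s q
  | id x =>
    intro _
    exact rootForm_id x
  | relabel e h t ih =>
    intro _
    have := t.finite
    exact RootForm.relabel ih e h
  | comp t u ih ih' =>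
    intro _
    have := t.finite
    have := fun i => (u i).finite
    exact .of_eq (bvComp_mk t u).symm (RootForm.comp ih fun i => ih' i)

theorem rootForm {S T : OmegaTree} {I : Type} [Finite I]
    {c : I → (BV S.operad T.operad).Color} {x : (BV S.operad T.operad).Color}
    (t : (BV S.operad T.operad).Op c x) : RootForm t := by
  induction t using Quotient.inductionOn with | _ t => exact rootForm_mk t

theorem shuffle_of_op {S T : OmegaTree} {I : Type} [Finite I]
    {c : I → (BV S.operad T.operad).Color} {x : (BV S.operad T.operad).Color}
    (t : (BV S.operad T.operad).Op c x) : Shuffle S T c x := by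
  induction t using Quotient.inductionOn with | _ t => exact t.shuffle

namespace Operad

variable {W : Operad} {I K : Type} [Finite I] [Finite K] {g : K → W.Color} {c : I → W.Color}
  {x : W.Color} {o : W.Op g x}

theorem isGraft_comp {J : K → Type} [∀ k, Finite (J k)] {b : ∀ k, J k → W.Color}
    (o : W.Op g x) (u : ∀ k, W.Op (b k) (g k)) : IsGraft o (W.comp o u) :=
  W.relabel_refl (W.comp o u) ▸ isGraft_relabel_comp o u (Equiv.refl _) fun _ => rfl

theorem IsGraft.of_eq {t t' : W.Op c x} (h : t = t') (ht : IsGraft o t') : IsGraft o t :=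
  h ▸ ht

theorem IsGraft.relabel {J : Type} [Finite J] {c' : J → W.Color} {t : W.Op c x}
    (ht : IsGraft o t) (e : I ≃ J) (h : ∀ i, c' (e i) = c i) : IsGraft o (W.relabel e h t) := by
  obtain ⟨π, u, rfl⟩ := ht
  refine .of_eq (W.relabel_trans _ _ _ _ _) ?_
  exact isGraft_relabel_comp o u _ _

/-- Two graftings onto `o` agree if their inputs determine the input of `o` below them, and
operations with output an input of `o` are determined by their inputs. -/
theorem IsGraft.unique (A : W.Color → K → Prop) (hA : ∀ y k k', A y k → A y k' → k = k')
    (hfib : ∀ (k : K) {J : Type} [Finite J] {b : J → W.Color}, W.Op b (g k) → ∀ j, A (b j) k)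
    (hsub : ∀ (k : K) {J : Type} [Finite J] {b : J → W.Color} (u u' : W.Op b (g k)), u = u')
    {t t' : W.Op c x} (ht : IsGraft o t) (ht' : IsGraft o t') : t = t' := by
  obtain ⟨π, u, rfl⟩ := ht
  obtain ⟨π', u', rfl⟩ := ht'
  obtain rfl : π = π' := funext fun i =>
    hA (c i) _ _ (hfib _ (u (π i)) ⟨i, rfl⟩) (hfib _ (u' (π' i)) ⟨i, rfl⟩)
  obtain rfl : u = u' := funext fun k => hsub k _ _
  rfl

end Operad

/-! ### For open `S`, an operation exists exactly for a shuffle, and is unique -/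

variable {S T : OmegaTree}

/-- If the bottom generator is a vertex of `S`, all operations grafted onto it still have `T`-colour
`T.out w` at their outputs. By induction `w` can be moved to the bottom of each of them, and the
interchange relation then moves it below the vertex of `S`. -/
theorem isGraft_bvRight (w : T.V) (s : S.E) : ∀ {I : Type} [Finite I]
    {c : I → (BV S.operad T.operad).Color} (t : (BV S.operad T.operad).Op c (s, T.out w)),
    (∀ i, (c i).2 ≠ T.out w) →
      Operad.IsGraft (W := BV S.operad T.operad) (bvRight s (T.vertexOp w)) t := by
  induction s using S.inp_induction with | h s ih => ?_
  intro I _ c t hc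
  -- Case analysis on `RootForm` needs the output to be a variable, hence the detour through `x`.
  suffices key : ∀ {x : (BV S.operad T.operad).Color} {t : (BV S.operad T.operad).Op c x}
      (hx : x = (s, T.out w)), RootForm t → Operad.IsGraft (W := BV S.operad T.operad)
        (bvRight s (T.vertexOp w)) (hx ▸ t : (BV S.operad T.operad).Op c (s, T.out w)) from
    key rfl (rootForm t)
  intro x t hx ht
  cases ht with
  | id e h => exact (hc (e ()) (congrArg Prod.snd ((h ()).trans hx))).elim
  | left v d e h u =>
    obtain ⟨rfl, rfl⟩ := Prod.mk.inj hx
    have hu : ∀ a : S.inp v, Operad.IsGraft (W := BV S.operad T.operad)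
        (bvRight a.1 (T.vertexOp w)) (u a) := fun a =>
      ih v rfl a a.2 (u a) fun j hj => hc (e ⟨a, j⟩) ((congrArg Prod.snd (h ⟨a, j⟩)).trans hj)
    choose π u' hu using hu
    obtain rfl := funext hu
    -- Every operation above `v` now starts with the same `w`, which is the situation of the
    -- interchange relation.
    obtain ⟨τ, hτ, heq⟩ := bv_interchange_comp (S.vertexOp v) (T.vertexOp w) u'
    refine Operad.IsGraft.relabel ?_ _ _
    refine .of_eq ((BV S.operad T.operad).comp_relabel_right _ _ _ _) ?_
    refine Operad.IsGraft.relabel ?_ _ _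
    refine .of_eq heq ?_
    refine Operad.IsGraft.relabel ?_ _ _
    exact Operad.isGraft_comp _ _
  | right w' s' e h u =>
    obtain ⟨rfl, hw⟩ := Prod.mk.inj hx
    obtain rfl := T.out_injective hw
    exact Operad.isGraft_relabel_comp _ _ _ _

/-- A vertex of `T` at the bottom would force all inputs to have a `T`-colour strictly above `d`,
against `hd`; an identity is excluded by `hc`. No interchange is needed. -/
theorem isGraft_bvLeft (v : S.V) (d : T.E) {I : Type} [Finite I]
    {c : I → (BV S.operad T.operad).Color} (t : (BV S.operad T.operad).Op c (S.out v, d))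
    (hc : ∀ i, (c i).1 ≠ S.out v) (hd : ∃ i, (c i).2 = d) :
    Operad.IsGraft (W := BV S.operad T.operad) (bvLeft (S.vertexOp v) d) t := by
  suffices key : ∀ {x : (BV S.operad T.operad).Color} {t : (BV S.operad T.operad).Op c x}
      (hx : x = (S.out v, d)), RootForm t → Operad.IsGraft (W := BV S.operad T.operad)
        (bvLeft (S.vertexOp v) d) (hx ▸ t : (BV S.operad T.operad).Op c (S.out v, d)) from
    key rfl (rootForm t)
  intro x t hx ht
  cases ht with
  | id e h => exact (hc (e ()) (congrArg Prod.fst ((h ()).trans hx))).elim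
  | left v' d e h u =>
    obtain ⟨hv, rfl⟩ := Prod.mk.inj hx
    obtain rfl := S.out_injective hv
    exact Operad.isGraft_relabel_comp _ _ _ _
  | right w s e h u =>
    obtain ⟨rfl, rfl⟩ := Prod.mk.inj hx
    obtain ⟨i, hi⟩ := hd
    obtain ⟨⟨a, j⟩, rfl⟩ := e.surjective i
    rw [h] at hi
    have := (shuffle_of_op (u a)).above_right j
    refine (out_ne_of_mem_inp a.2 (Above.antisymm (above_of_mem_inp a.2) ?_).symm).elim
    exact hi ▸ this

/-- This reads off from the inputs alone which generator may be placed at the bottom. The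
alternatives match the hypotheses of `isGraft_bvRight` and `isGraft_bvLeft`. -/
theorem Shuffle.cases (hS : S.IsOpen) {I : Type} {c : I → S.E × T.E} {x : S.E × T.E}
    (h : Shuffle S T c x) : (∃ i, c i = x) ∨ (∃ w, T.out w = x.2 ∧ ∀ i, (c i).2 ≠ x.2) ∨
      ∃ v, S.out v = x.1 ∧ (∀ i, (c i).1 ≠ x.1) ∧ ∃ i, (c i).2 = x.2 := by
  by_cases h1 : ∃ i, c i = x
  · exact .inl h1
  by_cases h2 : ∃ i, (c i).2 = x.2
  · obtain ⟨i, hi⟩ := h2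
    have hc : ∀ j, (c j).1 ≠ x.1 := by
      intro j hj
      -- An input with the `S`-colour of `x` and one with the `T`-colour of `x` are comparable in
      -- both coordinates, hence the same input, which then equals `x`.
      obtain rfl := h.eq_of_comparable i j (hj ▸ .inl (h.above_left i))
        (hi ▸ .inr (h.above_right j))
      exact h1 ⟨i, Prod.ext hj hi⟩
    obtain ⟨v, hv⟩ := not_forall_not.1 fun hl : S.IsLeaf x.1 =>
      hc i (hl.eq_of_above (h.above_left i))
    exact .inr (.inr ⟨v, hv, hc, i, hi⟩)
  · have hl : ¬ T.IsLeaf x.2 := fun hl => by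
      -- Openness of `S` enters here: without a leaf above `x.1` the covering condition would say
      -- nothing.
      obtain ⟨l, hlS, hlx⟩ := hS.exists_leaf x.1
      obtain ⟨i, -, hi⟩ := h.cover l x.2 hlS hl hlx .refl
      exact h2 ⟨i, (h.above_right i).antisymm hi⟩
    obtain ⟨w, hw⟩ := not_forall_not.1 hl
    exact .inr (.inl ⟨w, hw, not_exists.1 h2⟩)

/-- If `S` is open, an operation of `Ω(S) ⊗ Ω(T)` is determined by its inputs and output. -/
theorem bv_op_unique (hS : S.IsOpen) (s : S.E) : ∀ (d : T.E) {I : Type} [Finite I]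
    {c : I → (BV S.operad T.operad).Color} (p q : (BV S.operad T.operad).Op c (s, d)),
    p = q := by
  induction s using S.inp_induction with | h s ihs => ?_
  intro d
  induction d using T.inp_induction with | h d ihd => ?_
  intro I _ c p q
  obtain ⟨i, hi⟩ | ⟨w, rfl, hc⟩ | ⟨v, rfl, hc, hd⟩ := (shuffle_of_op p).cases hS
  -- A generating vertex at the bottom would put every input strictly above `x` in one coordinate,
  -- which the input `c i` is not.
  · have key : ∀ {x : (BV S.operad T.operad).Color} {t : (BV S.operad T.operad).Op c x},
        c i = x → RootForm t → ∃ (e : Unit ≃ I) (h : ∀ i, c (e i) = x),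
          t = (BV S.operad T.operad).relabel e h ((BV S.operad T.operad).id x) := by
      intro x t hx ht
      cases ht with
      | id e h => exact ⟨e, h, rfl⟩
      | left v d e h u =>
        obtain ⟨⟨a, j⟩, rfl⟩ := e.surjective i
        rw [h] at hx
        have := (congrArg Prod.fst hx).subst (motive := fun z => S.Above z a.1)
          ((shuffle_of_op (u a)).above_left j)
        refine (out_ne_of_mem_inp a.2 (Above.antisymm (above_of_mem_inp a.2) ?_).symm).elim
        exact this
      | right w s e h u =>
        obtain ⟨⟨a, j⟩, rfl⟩ := e.surjective i
        rw [h] at hx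
        have := (congrArg Prod.snd hx).subst (motive := fun z => T.Above z a.1)
          ((shuffle_of_op (u a)).above_right j)
        refine (out_ne_of_mem_inp a.2 (Above.antisymm (above_of_mem_inp a.2) ?_).symm).elim
        exact this
    obtain ⟨e, h, rfl⟩ := key hi (rootForm p)
    obtain ⟨e', h', rfl⟩ := key hi (rootForm q)
    -- The input set has a single element, so the two bijections agree.
    exact Operad.relabel_congr (fun _ => e.symm.injective (Subsingleton.elim _ _)) _ _ _
  · exact Operad.IsGraft.unique (W := BV S.operad T.operad) (fun y b => T.Above y.2 b.1)
      (fun y b b' h h' => Subtype.ext (input_unique b.2 b'.2 h h'))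
      (fun b _ _ _ u j => (shuffle_of_op u).above_right j)
      (fun b _ _ _ u u' => ihd w rfl b b.2 u u')
      (isGraft_bvRight w s p hc) (isGraft_bvRight w s q hc)
  · exact Operad.IsGraft.unique (W := BV S.operad T.operad) (fun y a => S.Above y.1 a.1)
      (fun y b b' h h' => Subtype.ext (input_unique b.2 b'.2 h h'))
      (fun b _ _ _ u j => (shuffle_of_op u).above_left j)
      (fun a _ _ _ u u' => ihs v rfl a a.2 d u u')
      (isGraft_bvLeft v d p hc hd) (isGraft_bvLeft v d q hc hd)

/-- For a leaf `l` above `a`, the input covering `l` belongs to the fibre over `a`, because `l`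
cannot lie above two different inputs of `v`. -/
theorem Shuffle.restrict_left {I : Type} {c : I → S.E × T.E} {v : S.V} {d : T.E}
    (h : Shuffle S T c (S.out v, d)) {π : I → S.inp v} (hπ : ∀ i, S.Above (c i).1 (π i))
    (a : S.inp v) : Shuffle S T (fun i : { i // π i = a } => c i.1) (a.1, d) := by
  refine ⟨by rintro ⟨i, rfl⟩; exact hπ i, fun i => h.above_right i.1,
    fun i j hi hj => Subtype.ext (h.eq_of_comparable i.1 j.1 hi hj), fun l m hl hm hla hmd => ?_⟩
  obtain ⟨i, hi, hi'⟩ := h.cover l m hl hm (hla.trans (above_of_mem_inp a.2)) hmd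
  exact ⟨⟨i, Subtype.ext (input_unique (π i).2 a.2 (hi.trans (hπ i)) hla)⟩, hi, hi'⟩

theorem Shuffle.restrict_right {I : Type} {c : I → S.E × T.E} {w : T.V} {s : S.E}
    (h : Shuffle S T c (s, T.out w)) {π : I → T.inp w} (hπ : ∀ i, T.Above (c i).2 (π i))
    (b : T.inp w) : Shuffle S T (fun i : { i // π i = b } => c i.1) (s, b.1) := by
  refine ⟨fun i => h.above_left i.1, by rintro ⟨i, rfl⟩; exact hπ i,
    fun i j hi hj => Subtype.ext (h.eq_of_comparable i.1 j.1 hi hj), fun l m hl hm hls hmb => ?_⟩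
  obtain ⟨i, hi, hi'⟩ := h.cover l m hl hm hls (hmb.trans (above_of_mem_inp b.2))
  exact ⟨⟨i, Subtype.ext (input_unique (π i).2 b.2 (hi'.trans (hπ i)) hmb)⟩, hi, hi'⟩

/-- If `S` is open, every shuffle is the list of inputs of an operation of `Ω(S) ⊗ Ω(T)`. -/
theorem Shuffle.nonempty_op (hS : S.IsOpen) (s : S.E) : ∀ (d : T.E) {I : Type} [Finite I]
    {c : I → S.E × T.E}, Shuffle S T c (s, d) →
      Nonempty ((BV S.operad T.operad).Op (c : I → (BV S.operad T.operad).Color) (s, d)) := by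
  induction s using S.inp_induction with | h s ihs => ?_
  intro d
  induction d using T.inp_induction with | h d ihd => ?_
  intro I _ c h
  obtain ⟨i, hi⟩ | ⟨w, rfl, hc⟩ | ⟨v, rfl, hc, -⟩ := h.cases hS
  · have hj : ∀ j, i = j := fun j => h.eq_of_comparable i j
      (.inr (hi ▸ h.above_left j)) (.inr (hi ▸ h.above_right j))
    exact ⟨(BV S.operad T.operad).relabel ⟨fun _ => i, fun _ => (), fun _ => rfl, hj⟩
      (fun _ => hi) ((BV S.operad T.operad).id (s, d))⟩
  · have hex : ∀ i, ∃ a : T.inp w, T.Above (c i).2 a := fun i => by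
      obtain ⟨a, ha, hia⟩ := (h.above_right i).exists_input (hc i)
      exact ⟨⟨a, ha⟩, hia⟩
    choose π hπ using hex
    have u := fun a : T.inp w => ihd w rfl a a.2 (h.restrict_right hπ a)
    exact ⟨(BV S.operad T.operad).relabel (Equiv.sigmaFiberEquiv π)
      (fun _ => rfl) ((BV S.operad T.operad).comp (bvRight s (T.vertexOp w))
        fun a => (u a).some)⟩
  · have hex : ∀ i, ∃ a : S.inp v, S.Above (c i).1 a := fun i => by
      obtain ⟨a, ha, hia⟩ := (h.above_left i).exists_input (hc i)
      exact ⟨⟨a, ha⟩, hia⟩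
    choose π hπ using hex
    have u := fun a : S.inp v => ihs v rfl a a.2 d (h.restrict_left hπ a)
    exact ⟨(BV S.operad T.operad).relabel (Equiv.sigmaFiberEquiv π)
      (fun _ => rfl) ((BV S.operad T.operad).comp (bvLeft (S.vertexOp v) d)
        fun a => (u a).some)⟩

theorem bv_hom_ext (hS : S.IsOpen) {R : Operad} {F G : R ⟶ BV S.operad T.operad}
    (h : ∀ r, F.onColor r = G.onColor r) : F = G := by
  obtain ⟨f, fo, _, _, _⟩ := F
  obtain ⟨g, go, _, _, _⟩ := G
  obtain rfl : f = g := funext h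
  refine Operad.Hom.ext rfl (heq_of_eq ?_)
  funext I _ c x p
  exact bv_op_unique hS _ _ _ _

/-- If `S` is open, a map of colours that sends operations to shuffles extends to a morphism of
operads. -/
theorem exists_hom_of_shuffle (hS : S.IsOpen) {R : Operad} (φ : R.Color → S.E × T.E)
    (h : ∀ {I : Type} [Finite I] {c : I → R.Color} {x : R.Color}, R.Op c x →
      Shuffle S T (fun i => φ (c i)) (φ x)) :
    ∃ F : R ⟶ BV S.operad T.operad, ∀ r, F.onColor r = φ r :=
  ⟨{ onColor := φ
     onOp := fun p => ((h p).nonempty_op hS _ _).some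
     map_id := fun _ => bv_op_unique hS _ _ _ _
     map_relabel := fun _ _ _ => bv_op_unique hS _ _ _ _
     map_comp := fun _ _ => bv_op_unique hS _ _ _ _ }, fun _ => rfl⟩

/-! ### Trees spanned by a set of edges of a given tree -/

namespace OmegaTree

theorem Above.of_eq {T : OmegaTree} {a b a' b' : T.E} (h : T.Above a b) (ha : a = a')
    (hb : b = b') : T.Above a' b' := ha ▸ hb ▸ h

/-- `T.Covers M b a`: the edge `b` lies strictly above `a` and no edge in `M` lies strictly
between them. -/
def Covers (T : OmegaTree) (M : Set T.E) (b a : T.E) : Prop :=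
  T.StrictAbove b a ∧ ∀ d ∈ M, T.Above b d → T.Above d a → d = b ∨ d = a

theorem exists_covers_above {T : OmegaTree} {M : Set T.E} {a b : T.E} (hb : b ∈ M)
    (h : T.StrictAbove b a) : ∃ b' ∈ M, T.Covers M b' a ∧ T.Above b b' := by
  -- The lowest edge of `M` that lies strictly above `a` on the path from `b`.
  obtain ⟨b', ⟨hb', hb'a, hbb'⟩, hmin⟩ := T.flip_strictAbove_wf.has_min
    {d | d ∈ M ∧ T.StrictAbove d a ∧ T.Above b d} ⟨b, hb, h, .refl⟩
  refine ⟨b', hb', ⟨hb'a, fun d hd hbd hda => ?_⟩, hbb'⟩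
  by_contra! hne
  exact hmin d ⟨hd, ⟨hda, hne.2⟩, hbb'.trans hbd⟩ ⟨hbd, hne.1.symm⟩

theorem exists_covers_below {T : OmegaTree} {M : Set T.E} {a b : T.E} (ha : a ∈ M)
    (h : T.StrictAbove b a) : ∃ a' ∈ M, T.Covers M b a' := by
  -- The highest edge of `M` strictly below `b`.
  obtain ⟨a', ⟨ha', hba'⟩, hmin⟩ := T.strictAbove_wf.has_min
    {d | d ∈ M ∧ T.StrictAbove b d} ⟨a, ha, h⟩
  refine ⟨a', ha', hba', fun d hd hbd hda' => ?_⟩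
  by_contra! hne
  exact hmin d ⟨hd, hbd, hne.1.symm⟩ ⟨hda', hne.2⟩

theorem Covers.eq_of_comparable {T : OmegaTree} {M : Set T.E} {a b b' : T.E} (hb : b ∈ M)
    (hb' : b' ∈ M) (h : T.Covers M b a) (h' : T.Covers M b' a) (hc : T.Comparable b b') :
    b = b' := by
  rcases hc with hc | hc
  · exact ((h.2 b' hb' hc h'.1.1).resolve_right h'.1.2).symm
  · exact (h'.2 b hb hc h.1.1).resolve_right h.1.2

/-- The tree whose edges are the edges in `M`, with root `t`, with a vertex below the edges
covering `e` for every `e` in `N`. -/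
def coverTree (T : OmegaTree) (M N : Set T.E) (t : M) (ht : ∀ e ∈ M, T.Above e t)
    (hN : ∀ e ∈ M, ∀ d ∈ M, T.StrictAbove d e → e ∈ N) : OmegaTree where
  E := M
  -- `hN` forces a vertex wherever `M` continues above `e`. Over a maximal edge of `M`, membership
  -- in `N` chooses between a bald vertex and a leaf.
  V := { e : M // e.1 ∈ N }
  finite_E := inferInstance
  out v := v.1
  inp v := { b | T.Covers M b v.1 }
  root := t
  out_injective := Subtype.val_injective
  inp_unique := by
    rintro e ⟨v, hv⟩ ⟨w, hw⟩ (h : T.Covers M e v) (h' : T.Covers M e w)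
    refine Subtype.ext (Subtype.ext ?_)
    rcases h.1.1.total h'.1.1 with hvw | hvw
    · exact (h'.2 v v.2 h.1.1 hvw).resolve_left h.1.2.symm
    · exact ((h.2 w w.2 h'.1.1 hvw).resolve_left h'.1.2.symm).symm
  root_notMem := fun v (h : T.Covers M t v.1) => h.1.2 (h.1.1.antisymm (ht _ v.1.2))
  reach_root := by
    rintro ⟨e, he⟩
    revert he
    induction e using T.flip_strictAbove_wf.induction with | _ e ih => ?_
    intro he
    by_cases het : e = t
    · subst het
      exact .refl
    · obtain ⟨a, ha, hea⟩ := exists_covers_below t.2 ⟨ht e he, het⟩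
      exact .head ⟨⟨⟨a, ha⟩, hN a ha e he hea.1⟩, hea, rfl⟩ (ih a hea.1 ha)

/-- The edges covering `e` form an antichain, and `hcover` says that it meets every path from a leaf
of `U` to `e`; by `span_of_cover` the vertex at `e` is therefore sent to a subtree of `U`. -/
theorem exists_hom_coverTree {T U : OmegaTree} {M N : Set T.E} {t : M}
    (ht : ∀ e ∈ M, T.Above e t) (hN : ∀ e ∈ M, ∀ d ∈ M, T.StrictAbove d e → e ∈ N) (j : U ⟶ T)
    (hj : Function.Injective j.onColor) (hM : ∀ e ∈ M, ∃ u, j.onColor u = e)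
    (hcover : ∀ e ∈ N, ∀ m, U.IsLeaf m → T.Above (j.onColor m) e →
      ∃ b ∈ M, T.StrictAbove b e ∧ T.Above (j.onColor m) b) :
    ∃ α : T.coverTree M N t ht hN ⟶ U, ∀ e : M, j.onColor (α.onColor e) = e.1 := by
  choose k hk using fun e : M => hM e e.2
  have hinj : Function.Injective k := fun a b h => Subtype.ext (by rw [← hk, h, hk])
  have hrefl : ∀ a b : M, T.Above a.1 b.1 → U.Above (k a) (k b) := fun a b h =>
    above_of_above_hom j hj (h.of_eq (hk a).symm (hk b).symm)
  have hpres : ∀ a b : M, U.Above (k a) (k b) → T.Above a.1 b.1 := fun a b h =>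
    (above_of_hom j h).of_eq (hk a) (hk b)
  refine ⟨homOfInjective (S := T.coverTree M N t ht hN) k hinj ?_, hk⟩
  rintro ⟨v, hv⟩
  refine span_of_cover _ _ ?_ ?_ ?_
  · rintro _ ⟨b, hb, rfl⟩
    exact hrefl b v (show T.Covers M b.1 v.1 from hb).1.1
  · rintro _ ⟨b, hb, rfl⟩ _ ⟨b', hb', rfl⟩ h
    exact congrArg k (Subtype.ext
      (Covers.eq_of_comparable b.2 b'.2 hb hb' (.inl (hpres b b' h))))
  · intro m hm hmv
    have hmv' : T.Above (j.onColor m) v.1 :=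
      (above_of_hom j hmv).of_eq rfl (hk v)
    obtain ⟨b, hb, hbv, hmb⟩ := hcover v.1 hv m hm hmv'
    obtain ⟨b', hb', hcov, hbb'⟩ := exists_covers_above hb hbv
    refine ⟨k ⟨b', hb'⟩, ⟨⟨b', hb'⟩, hcov, rfl⟩, above_of_above_hom j hj ?_⟩
    exact Above.of_eq (hmb.trans hbb') rfl (hk ⟨b', hb'⟩).symm

end OmegaTree

/-! ### A common lift through a family of subobjects -/

/-- If `S` is open, a dendrex of `S ⊗ T` whose colours lie in `S ⊗ U i` and which lifts to
`S ⊗ U i`, for all subobjects `U i` of `T` in a family, lifts to `S ⊗ T'` for some tree `T'` that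
maps to all `U i`. -/
theorem exists_common_lift (hS : S.IsOpen) {R : OmegaTree} {ι : Type} [Nonempty ι]
    {U : ι → OmegaTree} (j : ∀ i, U i ⟶ T) (hj : ∀ i, Function.Injective (j i).onColor)
    (f : R.E → S.E × T.E) (g : ∀ i, R.operad ⟶ BV S.operad (U i).operad)
    (hg : ∀ i r, (((g i).onColor r).1, (j i).onColor ((g i).onColor r).2) = f r) :
    ∃ (T' : OmegaTree) (α : ∀ i, T' ⟶ U i) (k : T'.E → T.E)
      (h : R.operad ⟶ BV S.operad T'.operad), (∀ i e, (j i).onColor ((α i).onColor e) = k e) ∧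
        ∀ r, ((h.onColor r).1, k (h.onColor r).2) = f r := by
  obtain ⟨i₀⟩ := ‹Nonempty ι›
  have hg1 : ∀ i r, ((g i).onColor r).1 = (f r).1 := fun i r => congrArg Prod.fst (hg i r)
  have hg2 : ∀ i r, (j i).onColor ((g i).onColor r).2 = (f r).2 :=
    fun i r => congrArg Prod.snd (hg i r)
  have hU : ∀ i r r', T.Above (f r).2 (f r').2 →
      (U i).Above ((g i).onColor r).2 ((g i).onColor r').2 := fun i r r' h =>
    above_of_above_hom (j i) (hj i) (h.of_eq (hg2 i r).symm (hg2 i r').symm)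
  have hleafU : ∀ i m r, T.Above ((j i).onColor m) (f r).2 →
      (U i).Above m ((g i).onColor r).2 := fun i m r h =>
    above_of_above_hom (j i) (hj i) (h.of_eq rfl (hg2 i r).symm)
  have hT : ∀ i r r', (U i).Above ((g i).onColor r).2 ((g i).onColor r').2 →
      T.Above (f r).2 (f r').2 := fun i r r' h =>
    (above_of_hom (j i) h).of_eq (hg2 i r) (hg2 i r')
  have hvert : ∀ i v, Shuffle S (U i) (fun a : R.inp v => (g i).onColor a.1)
      ((g i).onColor (R.out v)) := fun i v => shuffle_of_op ((g i).onOp (R.vertexOp v))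
  have hstep : ∀ v, ∀ r ∈ R.inp v, T.Above (f r).2 (f (R.out v)).2 := fun v r hr =>
    hT i₀ _ _ ((hvert i₀ v).above_right ⟨r, hr⟩)
  have hroot : ∀ r, T.Above (f r).2 (f R.root).2 := fun r => by
    refine Relation.ReflTransGen.head_induction_on (R.reach_root r) .refl ?_
    rintro r _ ⟨v, hv, rfl⟩ _ ih
    exact (hstep v r hv).trans ih
  let M : Set T.E := Set.range fun r => (f r).2
  -- The edges that may carry a vertex: this is the covering condition that `exists_hom_coverTree`
  -- requires, imposed for all `U i` at once.
  let N : Set T.E := {e | ∀ i m, (U i).IsLeaf m → T.Above ((j i).onColor m) e →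
    ∃ b ∈ M, T.StrictAbove b e ∧ T.Above ((j i).onColor m) b}
  have hN : ∀ e ∈ M, ∀ d ∈ M, T.StrictAbove d e → e ∈ N := by
    rintro e ⟨r₀, rfl⟩ _ ⟨r, rfl⟩
    contrapose
    intro he
    -- A leaf `m` of some `U i` witnesses that the edge `e = (f r₀).2` is not in `N`. Climbing `R`
    -- from its root, no colour can then have its `T`-part strictly above `e`.
    obtain ⟨i, m, hm, hme, hno⟩ : ∃ i m, (U i).IsLeaf m ∧ T.Above ((j i).onColor m) (f r₀).2 ∧
        ∀ b ∈ M, T.StrictAbove b (f r₀).2 → ¬ T.Above ((j i).onColor m) b := by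
      simpa [N] using he
    refine Relation.ReflTransGen.head_induction_on
      (motive := fun r _ => ¬ T.StrictAbove (f r).2 (f r₀).2) (R.reach_root r) ?_ ?_
    · exact fun h => h.2 (h.1.antisymm (hroot r₀))
    · rintro r _ ⟨v, hv, rfl⟩ _ ih hr
      have hout : T.Above (f r₀).2 (f (R.out v)).2 := by
        rcases hr.1.total (hstep v r hv) with h | h
        · exact h
        · by_contra hne
          exact ih ⟨h, fun h' => hne (h' ▸ .refl)⟩
      -- Suppose `r` were the first to pass above `e`. The input `a` of `v` covering the pair `(l,
      -- m)` cannot have `T`-part strictly above `e`, by the choice of `m`. Hence `r` and `a` are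
      -- comparable in both coordinates, so `r = a`, a contradiction.
      obtain ⟨l, hl, hlr⟩ := hS.exists_leaf (f r).1
      have hsh := hvert i v
      obtain ⟨⟨a, ha⟩, hla, hma⟩ := hsh.cover l m hl hm
        (hlr.trans ((hsh.above_left ⟨r, hv⟩).of_eq (hg1 i r) rfl)) (hleafU i m _ (hme.trans hout))
      have hma' : T.Above ((j i).onColor m) (f a).2 := (above_of_hom (j i) hma).of_eq rfl (hg2 i a)
      have hea : T.Above (f r₀).2 (f a).2 := by
        rcases hme.total hma' with h | h
        · exact h
        · by_contra hne
          exact hno _ ⟨a, rfl⟩ ⟨h, fun h' => hne (h' ▸ .refl)⟩ hma'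
      have hra := hsh.eq_of_comparable ⟨r, hv⟩ ⟨a, ha⟩
        (Above.total (hlr.of_eq rfl (hg1 i r).symm) hla) (.inl (hU i r a (hr.1.trans hea)))
      obtain rfl : r = a := congrArg Subtype.val hra
      exact hno _ ⟨r, rfl⟩ hr hma'
  let t : M := ⟨(f R.root).2, R.root, rfl⟩
  have ht : ∀ e ∈ M, T.Above e t := by
    rintro _ ⟨r, rfl⟩
    exact hroot r
  have hα : ∀ i, ∃ α : T.coverTree M N t ht hN ⟶ U i,
      ∀ e : M, (j i).onColor (α.onColor e) = e.1 := fun i =>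
    exists_hom_coverTree ht hN (j i) (hj i) (by rintro _ ⟨r, rfl⟩; exact ⟨_, hg2 i r⟩)
      fun e he m hm => he i m hm
  choose α hα using hα
  have hαinj : Function.Injective (α i₀).onColor := fun a b h =>
    Subtype.ext ((hα i₀ a).symm.trans ((congrArg (j i₀).onColor h).trans (hα i₀ b)))
  have hrefl : ∀ a b : M, T.Above a.1 b.1 → (T.coverTree M N t ht hN).Above a b := fun a b h =>
    above_of_above_hom (α i₀) hαinj
      (above_of_above_hom (j i₀) (hj i₀) (h.of_eq (hα i₀ a).symm (hα i₀ b).symm))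
  have hpres : ∀ a b : M, (T.coverTree M N t ht hN).Above a b → T.Above a.1 b.1 := fun a b h =>
    (above_of_hom (j i₀) (above_of_hom (α i₀) h)).of_eq (hα i₀ a) (hα i₀ b)
  obtain ⟨h, hh⟩ := exists_hom_of_shuffle (R := R.operad) (T := T.coverTree M N t ht hN) hS
    (fun r => ((f r).1, (⟨(f r).2, r, rfl⟩ : M))) (by
      intro I _ c x p
      have hsh : ∀ i, Shuffle S (U i) (fun a => (g i).onColor (c a)) ((g i).onColor x) :=
        fun i => shuffle_of_op ((g i).onOp p)
      refine ⟨fun a => ?_, fun a => hrefl _ _ (hT i₀ _ _ ((hsh i₀).above_right a)),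
        fun a b hab hab' => (hsh i₀).eq_of_comparable a b ?_ ?_, fun l m hl hm hlx hmx => ?_⟩
      · exact ((hsh i₀).above_left a).of_eq (hg1 i₀ _) (hg1 i₀ _)
      · exact hab.imp (fun h => h.of_eq (hg1 i₀ _).symm (hg1 i₀ _).symm)
          (fun h => h.of_eq (hg1 i₀ _).symm (hg1 i₀ _).symm)
      · exact hab'.imp (fun h => hU i₀ _ _ (hpres _ _ h)) (fun h => hU i₀ _ _ (hpres _ _ h))
      -- A leaf of the new tree is not in `N`, so some leaf `n` of some `U i` lies above `m` with no
      -- edge of `M` in between. The input covering `(l, n)` in `S ⊗ U i` then has its `T`-part at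
      -- or below `m`.
      · have hmN : (m : M).1 ∉ N := fun h => hm ⟨m, h⟩ rfl
        obtain ⟨i, n, hn, hnm, hno⟩ : ∃ i n, (U i).IsLeaf n ∧
            T.Above ((j i).onColor n) (m : M).1 ∧
            ∀ b ∈ M, T.StrictAbove b (m : M).1 → ¬ T.Above ((j i).onColor n) b := by
          simpa [N] using hmN
        obtain ⟨a, hla, hna⟩ := (hsh i).cover l n hl hn (hlx.of_eq rfl (hg1 i x).symm)
          (hleafU i n x (hnm.trans (hpres _ _ hmx)))
        have hna' : T.Above ((j i).onColor n) (f (c a)).2 := (above_of_hom (j i) hna).of_eq rfl (hg2 i (c a))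
        refine ⟨a, hla.of_eq rfl (hg1 i (c a)), hrefl _ _ ?_⟩
        rcases hnm.total hna' with h | h
        · exact h
        · by_contra hne
          exact hno _ ⟨c a, rfl⟩ ⟨h, fun h' => hne (h' ▸ .refl)⟩ hna')
  exact ⟨_, α, Subtype.val, h, hα, fun r => by rw [hh]; rfl⟩

/-! ### Elementary faces and membership in `A ⊗ B` -/

theorem OmegaTree.FaceIndex.map_injective (y : T.FaceIndex) :
    Function.Injective y.map.onColor := by
  cases y with
  | inner x hx => exact Subtype.val_injective
  | top v hv => exact Subtype.val_injective
  | root r hr x hx hi hu => exact Subtype.val_injective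
  | edge h e => exact fun _ _ _ => rfl

theorem OmegaTree.IsOpen.face (hT : T.IsOpen) (y : T.FaceIndex) : y.tree.IsOpen := by
  cases y with
  | inner x hx =>
    rintro ⟨u, hu⟩
    obtain ⟨a, ha⟩ := hT u
    by_cases hax : a = x
    -- If the chosen input is the contracted edge, an input of the vertex `w` merged into `u`
    -- replaces it.
    · subst hax
      obtain ⟨w, hw⟩ := not_forall_not.1 hx.2
      obtain ⟨b, hb⟩ := hT w
      exact ⟨⟨b, fun h => out_ne_of_mem_inp hb (hw.trans h.symm)⟩, .inr ⟨ha, w, hw, hb⟩⟩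
    · exact ⟨⟨a, hax⟩, .inl ha⟩
  | top v hv =>
    rintro ⟨u, hu⟩
    obtain ⟨a, ha⟩ := hT u
    exact ⟨⟨a, fun h => hu (T.inp_unique ha h)⟩, ha⟩
  | root r hr x hx hi hu =>
    rintro ⟨u, hu⟩
    obtain ⟨a, ha⟩ := hT u
    exact ⟨⟨a, Relation.ReflTransGen.trans (above_of_mem_inp ha) hu⟩, ha⟩
  | edge h e => exact fun v => v.elim

theorem mem_tensorSub {A : Subfunctor (rep S)} {B : Subfunctor (rep T)} {R : OmegaTree}
    (f : R.operad ⟶ BV S.operad T.operad) :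
    f ∈ (tensorSub A B).obj (Opposite.op R) ↔
      ∃ (S' T' : OmegaTree) (a : A.obj (Opposite.op S')) (b : B.obj (Opposite.op T'))
        (g : R.operad ⟶ BV S'.operad T'.operad), g ≫ BV.map a.1 b.1 = f := by
  have h : ((tensorSub A B).obj (Opposite.op R) : Set (R.operad ⟶ BV S.operad T.operad)) =
      ⋃ (S' : OmegaTree) (T' : OmegaTree) (a : A.obj (Opposite.op S'))
        (b : B.obj (Opposite.op T')),
        Set.range fun g : R.operad ⟶ BV S'.operad T'.operad => g ≫ BV.map a.1 b.1 := by
    simp only [tensorSub, Subfunctor.iSup_obj]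
    rfl
  refine (Iff.of_eq (congrArg
    (fun X : Set (R.operad ⟶ BV S.operad T.operad) => f ∈ X) h)).trans ?_
  simp only [Set.mem_iUnion]
  rfl

theorem mem_face {R : OmegaTree} {y : T.FaceIndex} (f : R ⟶ T) :
    f ∈ (face y).obj (Opposite.op R) ↔ ∃ g : R ⟶ y.tree, g ≫ y.map = f := Iff.rfl

theorem tensorSub_mono {A A' : Subfunctor (rep S)} {B B' : Subfunctor (rep T)} (hA : A ≤ A')
    (hB : B ≤ B') : tensorSub A B ≤ tensorSub A' B' := by
  rintro ⟨R⟩ f hf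
  obtain ⟨S', T', a, b, g, hg⟩ := (mem_tensorSub f).1 hf
  exact (mem_tensorSub f).2 ⟨S', T', ⟨a.1, hA _ a.2⟩, ⟨b.1, hB _ b.2⟩, g, hg⟩

/-- A dendrex of `A ⊗ ∂_y T` comes from a dendrex of `S ⊗ ∂_y T`. -/
theorem exists_lift_right {A : Subfunctor (rep S)} {y : T.FaceIndex} {R : OmegaTree}
    {f : R.operad ⟶ BV S.operad T.operad}
    (hf : f ∈ (tensorSub A (face y)).obj (Opposite.op R)) :
    ∃ g : R.operad ⟶ BV S.operad y.tree.operad,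
      ∀ r, ((g.onColor r).1, y.map.onColor (g.onColor r).2) = f.onColor r := by
  obtain ⟨S', T', ⟨a, ha⟩, ⟨b, hb⟩, g, rfl⟩ := (mem_tensorSub f).1 hf
  obtain ⟨b', rfl⟩ := (mem_face b).1 hb
  exact ⟨g ≫ BV.map (operadFunctor.map a) (operadFunctor.map b'), fun r => rfl⟩

theorem exists_lift_left {B : Subfunctor (rep T)} {x : S.FaceIndex} {R : OmegaTree}
    {f : R.operad ⟶ BV S.operad T.operad}
    (hf : f ∈ (tensorSub (face x) B).obj (Opposite.op R)) :
    ∃ g : R.operad ⟶ BV x.tree.operad T.operad,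
      ∀ r, (x.map.onColor (g.onColor r).1, (g.onColor r).2) = f.onColor r := by
  obtain ⟨S', T', ⟨a, ha⟩, ⟨b, hb⟩, g, rfl⟩ := (mem_tensorSub f).1 hf
  obtain ⟨a', rfl⟩ := (mem_face a).1 ha
  exact ⟨g ≫ BV.map (operadFunctor.map a') (operadFunctor.map b), fun r => rfl⟩

/-! ### The two intersection formulas -/

theorem tensorSub_top_face_inf (hS : S.IsOpen) (y z : T.FaceIndex) :
    tensorSub (⊤ : Subfunctor (rep S)) (face y) ⊓ tensorSub (⊤ : Subfunctor (rep S)) (face z) =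
      tensorSub (⊤ : Subfunctor (rep S)) (face y ⊓ face z) := by
  refine le_antisymm ?_
    (le_inf (tensorSub_mono le_rfl inf_le_left) (tensorSub_mono le_rfl inf_le_right))
  rintro ⟨R⟩ f ⟨hy, hz⟩
  have hg : ∀ i : Bool, ∃ g : R.operad ⟶ BV S.operad (cond i y z).tree.operad,
      ∀ r, ((g.onColor r).1, (cond i y z).map.onColor (g.onColor r).2) = f.onColor r := by
    rintro (_ | _)
    · exact exists_lift_right hz
    · exact exists_lift_right hy
  choose g hg using hg
  obtain ⟨T', α, k, h, hα, hh⟩ := exists_common_lift hS (fun i => (cond i y z).map)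
    (fun i => (cond i y z).map_injective) f.onColor g hg
  -- The two composites agree on edges, so they are one morphism `T' ⟶ T`, which lies in both faces.
  have hyz : α true ≫ y.map = α false ≫ z.map :=
    OmegaTree.hom_ext fun e => (hα true e).trans (hα false e).symm
  refine (mem_tensorSub f).2 ⟨S, T', ⟨𝟙 S, trivial⟩, ⟨α true ≫ y.map,
    (mem_face _).2 ⟨α true, rfl⟩, (mem_face _).2 ⟨α false, hyz.symm⟩⟩, h, ?_⟩
  refine bv_hom_ext hS fun r => Eq.trans (b := ((h.onColor r).1, k (h.onColor r).2)) ?_ (hh r)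
  exact congrArg (Prod.mk (h.onColor r).1) (hα true (h.onColor r).2)

theorem tensorSub_face_inf (hS : S.IsOpen) (hT : T.IsOpen) (x : S.FaceIndex)
    (y : T.FaceIndex) :
    tensorSub (face x) (⊤ : Subfunctor (rep T)) ⊓ tensorSub (⊤ : Subfunctor (rep S)) (face y) =
      tensorSub (face x) (face y) := by
  refine le_antisymm ?_ (le_inf (tensorSub_mono le_rfl le_top) (tensorSub_mono le_top le_rfl))
  rintro ⟨R⟩ f ⟨hx, hy⟩
  obtain ⟨g, hg⟩ := exists_lift_left hx
  obtain ⟨g', hg'⟩ := exists_lift_right hy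
  have hgg : ∀ r, y.map.onColor (g'.onColor r).2 = (g.onColor r).2 := fun r =>
    (congrArg Prod.snd (hg' r)).trans (congrArg Prod.snd (hg r)).symm
  obtain ⟨h, hh⟩ := exists_hom_of_shuffle (S := x.tree) (T := y.tree) (R := R.operad)
    (hS.face x) (fun r => ((g.onColor r).1, (g'.onColor r).2)) (by
      intro I _ c r p
      have hs := shuffle_of_op (g.onOp p)
      have hs' := shuffle_of_op (g'.onOp p)
      refine ⟨hs.above_left, hs'.above_right, fun i j hij hij' => hs.eq_of_comparable i j hij
        (hij'.imp (fun h => (above_of_hom y.map h).of_eq (hgg _) (hgg _))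
          (fun h => (above_of_hom y.map h).of_eq (hgg _) (hgg _))), fun l m hl hm hlr hmr => ?_⟩
      -- `m` may fail to be a leaf of `T`, so a leaf `n` of `T` above it is covered instead. The
      -- `T`-part of the covering input is comparable to `m`; if it lies above `m`, it equals `m`,
      -- since it comes from `∂_yT`, where `m` is a leaf.
      obtain ⟨n, hn, hnm⟩ := hT.exists_leaf (y.map.onColor m)
      obtain ⟨i, hli, hni⟩ := hs.cover l n hl hn hlr
        (Relation.ReflTransGen.trans hnm ((above_of_hom y.map hmr).of_eq rfl (hgg _)))
      refine ⟨i, hli, ?_⟩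
      rcases Above.total hnm hni with h | h
      · exact above_of_above_hom y.map y.map_injective (h.of_eq rfl (hgg _).symm)
      · have := above_of_above_hom y.map y.map_injective (h.of_eq (hgg _).symm rfl)
        exact hm.eq_of_above this ▸ .refl)
  refine (mem_tensorSub f).2 ⟨x.tree, y.tree, ⟨x.map, (mem_face _).2 ⟨𝟙 _, rfl⟩⟩,
    ⟨y.map, (mem_face _).2 ⟨𝟙 _, rfl⟩⟩, h, ?_⟩
  refine bv_hom_ext hS fun r => ?_
  refine Eq.trans (b := (x.map.onColor (g.onColor r).1, y.map.onColor (g'.onColor r).2)) ?_ ?_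
  · exact congrArg (fun z => (x.map.onColor z.1, y.map.onColor z.2)) (hh r)
  · exact (congrArg (Prod.mk (x.map.onColor (g.onColor r).1)) (hgg r)).trans (hg r)

end Dendroidal

theorem mainTheorem4 (S T : Dendroidal.OmegaTree) :
    (S.IsOpen → ∀ y z : T.FaceIndex,
      Dendroidal.tensorSub (⊤ : CategoryTheory.Subfunctor (Dendroidal.rep S))
          (Dendroidal.face y) ⊓
        Dendroidal.tensorSub (⊤ : CategoryTheory.Subfunctor (Dendroidal.rep S))
          (Dendroidal.face z) =
      Dendroidal.tensorSub (⊤ : CategoryTheory.Subfunctor (Dendroidal.rep S))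
        (Dendroidal.face y ⊓ Dendroidal.face z)) ∧
    (S.IsOpen → T.IsOpen → ∀ (x : S.FaceIndex) (y : T.FaceIndex),
      Dendroidal.tensorSub (Dendroidal.face x)
          (⊤ : CategoryTheory.Subfunctor (Dendroidal.rep T)) ⊓
        Dendroidal.tensorSub (⊤ : CategoryTheory.Subfunctor (Dendroidal.rep S))
          (Dendroidal.face y) =
      Dendroidal.tensorSub (Dendroidal.face x) (Dendroidal.face y)) :=
  ⟨Dendroidal.tensorSub_top_face_inf, Dendroidal.tensorSub_face_inf⟩
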